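/- Let $\Omega$ (states), $M$ (messages) and $A$ (actions) be finite sets, let $u_S,u_R:\Omega\times A\to\mathbb R$, and write $\Delta(X)$ for the set of probability distributions on a finite set $X$. Let $Q(\omega'\mid\omega)$ be the transition probabilities of an irreducible and aperiodic Markov chain on $\Omega$ that is pseudo-renewal: there are numbers $\beta_\omega\ge 0$ with $\sum_{\omega}\beta_\omega\le 1$ and $Q(\omega\mid\tilde\omega)=\beta_\omega$ whenever $\omega\ne\tilde\omega$. Let $\mu\in\Delta(\Omega)$ be its invariant distribution. Dynamic game. The state $\omega_1$ is drawn from $\mu$, and then $(\omega_n)_{n\ge 1}$ evolves according to $Q$. In each period $n\ge 1$ the sender observes $\omega_n$ and sends $m_n\in M$; the receiver observes $m_n$ and chooses $a_n\in A$, which the sender does not observe; neither player observes realized payoffs. A sender strategy is a sequence of maps $\sigma_n:(\Omega\times M)^{n-1}\times\Omega\to\Delta(M)$ of the past states and messages and the current state; a receiver strategy is a sequence of maps $\tau_n:(M\times A)^{n-1}\times M\to\Delta(A)$ of the past messages and actions and the current message. For $\delta\in(0,1)$ and $i\in\{S,R\}$ put $$\gamma_i^\delta(\sigma,\tau)=\mathbb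 E_{\sigma,\tau}\Big[(1-\delta)\sum_{n\ge 1}\delta^{n-1}u_i(\omega_n,a_n)\Big].$$ A vector $\gamma=(\gamma_S,\gamma_R)\in\mathbb R^2$ is a uniform equilibrium payoff if for every $\varepsilon>0$ there are $\delta_0\in(0,1)$ and a strategy profile $(\sigma^*,\tau^*)$ such that for all $\delta\in[\delta_0,1)$: $\gamma_S^\delta(\tilde\sigma,\tau^*)\le\gamma_S^\delta(\sigma^*,\tau^*)+\varepsilon$ for every sender strategy $\tilde\sigma$; $\gamma_R^\delta(\sigma^*,\tilde\tau)\le\gamma_R^\delta(\sigma^*,\tau^*)+\varepsilon$ for every receiver strategy $\tilde\tau$; and $\|(\gamma_S^\delta,\gamma_R^\delta)(\sigma^*,\tau^*)-\gamma\|_\infty\le\varepsilon$. Let $\mathcal U$ be the set of uniform equilibrium payoffs. Static persuasion with partial commitment. For $\pi\in\Delta(\Omega)$ and $\lambda\in\Delta(M)$ let $\Sigma(\pi,\lambda)$ be the set of families $(p_m)_{m\in M}$ in $\Delta(\Omega)$ with $\sum_m\lambda(m)p_m=\pi$. An equilibrium with prior $\pi$ and message marginal $\lambda$ is a pair of $(p_m)_{m\in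 M}\in\Sigma(\pi,\lambda)$ and $\kappa:M\to\Delta(A)$ such that (i) for every $m$ with $\lambda(m)>0$, every action $a$ with $\kappa(a\mid m)>0$ maximizes $\sum_\omega p_m(\omega)u_R(\omega,\cdot)$ over $A$; and (ii) for every $(\tilde p_m)_{m\in M}\in\Sigma(\pi,\lambda)$, $$\sum_m\lambda(m)\sum_\omega\bigl(p_m(\omega)-\tilde p_m(\omega)\bigr)\sum_a\kappa(a\mid m)u_S(\omega,a)\ge 0 .$$ Its payoff vector has the coordinates $\sum_m\lambda(m)\sum_\omega p_m(\omega)\sum_a\kappa(a\mid m)u_i(\omega,a)$, $i\in\{S,R\}$. Let $\mathcal E(\pi,\lambda)$ be the set of all such payoff vectors. Theorem. For every $\lambda\in\Delta(M)$, $\mathcal E(\mu,\lambda)\subseteq\mathcal U$; and every convex combination of such payoffs across message distributions is a uniform equilibrium payoff: $$\mathrm{Co}_\lambda\bigl(\mathcal E(\mu,\lambda)\bigr):=\mathrm{conv}\Bigl(\bigcup_{\lambda\in\Delta(M)}\mathcal E(\mu,\lambda)\Bigr)\subseteq\mathcal U .$$ -/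

import Mathlib

namespace Persuasion

/-! ### The state process -/

section Chain

variable {Ω : Type*}

/-- `Q ω ω'` is the probability of moving from `ω` to `ω'`. The chain is pseudo-renewal if the
probability of moving between two distinct states depends only on the destination, and these
destination probabilities are non-negative with sum at most one. -/
def IsPseudoRenewal [Fintype Ω] (Q : Matrix Ω Ω ℝ) : Prop :=
  ∃ β : Ω → ℝ, (∀ ω, 0 ≤ β ω) ∧ ∑ ω, β ω ≤ 1 ∧ ∀ ω ω', ω ≠ ω' → Q ω' ω = β ω

/-- Every state has period one: the only common divisor of its possible return times is `1`. -/
def IsAperiodic [Fintype Ω] [DecidableEq Ω] (Q : Matrix Ω Ω ℝ) : Prop :=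
  ∀ ω : Ω, ∀ d : ℕ, (∀ n : ℕ, 0 < n → 0 < (Q ^ n) ω ω → d ∣ n) → d = 1

/-- `μ` is an invariant distribution of the chain with transition matrix `Q`. -/
def IsInvariantDist [Fintype Ω] (Q : Matrix Ω Ω ℝ) (μ : stdSimplex ℝ Ω) : Prop :=
  ∀ ω', ∑ ω, μ ω * Q ω ω' = μ ω'

end Chain

/-! ### The dynamic game without feedback

Periods are numbered from `0`, so that in period `n` exactly `n` periods have already been played.
Distributions on a finite set `X` are elements of `stdSimplex ℝ X`. -/

/-- A behaviour strategy of the sender: in period `n` it maps the `n` past pairs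
(state, message) and the current state to a distribution over messages. -/
def SenderStrategy (Ω M : Type*) [Fintype M] : Type _ :=
  (n : ℕ) → (Fin n → Ω × M) → Ω → stdSimplex ℝ M

/-- A behaviour strategy of the receiver: in period `n` it maps the `n` past pairs
(message, action) and the current message to a distribution over actions. -/
def ReceiverStrategy (M A : Type*) [Fintype A] : Type _ :=
  (n : ℕ) → (Fin n → M × A) → M → stdSimplex ℝ A

section Dynamic

variable {Ω M A : Type*} [Fintype Ω] [Fintype M] [Fintype A]

/-- The probability that the next state is `ω` when `n` periods have been played with
outcome `h`: the initial distribution if `n = 0`, the transition probability from the last state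
otherwise. -/
def nextStateProb (Q : Matrix Ω Ω ℝ) (μ : stdSimplex ℝ Ω) :
    (n : ℕ) → (Fin n → Ω × M × A) → Ω → ℝ
  | 0, _, ω => μ ω
  | n + 1, h, ω => Q (h (Fin.last n)).1 ω

/-- The probability that the first `n` periods are played as `h`, where `h k` is the triple
(state, message, action) of period `k`. -/
def playProb (Q : Matrix Ω Ω ℝ) (μ : stdSimplex ℝ Ω)
    (σ : SenderStrategy Ω M) (τ : ReceiverStrategy M A) :
    (n : ℕ) → (Fin n → Ω × M × A) → ℝ
  | 0, _ => 1
  | n + 1, h =>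
    let past : Fin n → Ω × M × A := fun k => h k.castSucc
    let ω : Ω := (h (Fin.last n)).1
    let m : M := (h (Fin.last n)).2.1
    let a : A := (h (Fin.last n)).2.2
    playProb Q μ σ τ n past
      * nextStateProb Q μ n past ω
      * σ n (fun k => ((past k).1, (past k).2.1)) ω m
      * τ n (fun k => ((past k).2.1, (past k).2.2)) m a

/-- The expected stage payoff `𝔼[u(ωₙ, aₙ)]` in period `n`. -/
noncomputable def expectedStagePayoff (Q : Matrix Ω Ω ℝ) (μ : stdSimplex ℝ Ω)
    (u : Ω → A → ℝ) (σ : SenderStrategy Ω M) (τ : ReceiverStrategy M A) (n : ℕ) : ℝ :=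
  ∑ h : Fin (n + 1) → Ω × M × A,
    playProb Q μ σ τ (n + 1) h * u (h (Fin.last n)).1 (h (Fin.last n)).2.2

/-- The `δ`-discounted payoff. Stage payoffs are bounded, so for `0 ≤ δ < 1` the series converges
absolutely and is the expectation of the discounted sum of the stage payoffs. -/
noncomputable def discountedPayoff (Q : Matrix Ω Ω ℝ) (μ : stdSimplex ℝ Ω)
    (u : Ω → A → ℝ) (δ : ℝ) (σ : SenderStrategy Ω M) (τ : ReceiverStrategy M A) : ℝ :=
  (1 - δ) * ∑' n : ℕ, δ ^ n * expectedStagePayoff Q μ u σ τ n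

/-- The set of uniform equilibrium payoffs (sender, receiver) of the dynamic game with message
set `M`. The norm on `ℝ × ℝ` is the maximum norm. -/
def uniformEquilibriumPayoffs (M : Type*) [Fintype M] (Q : Matrix Ω Ω ℝ) (μ : stdSimplex ℝ Ω)
    (uS uR : Ω → A → ℝ) : Set (ℝ × ℝ) :=
  {γ | ∀ ε : ℝ, 0 < ε → ∃ δ₀ : ℝ, 0 < δ₀ ∧ δ₀ < 1 ∧
    ∃ (σ : SenderStrategy Ω M) (τ : ReceiverStrategy M A), ∀ δ : ℝ, δ₀ ≤ δ → δ < 1 →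
      (∀ σ' : SenderStrategy Ω M,
        discountedPayoff Q μ uS δ σ' τ ≤ discountedPayoff Q μ uS δ σ τ + ε) ∧
      (∀ τ' : ReceiverStrategy M A,
        discountedPayoff Q μ uR δ σ τ' ≤ discountedPayoff Q μ uR δ σ τ + ε) ∧
      ‖(discountedPayoff Q μ uS δ σ τ, discountedPayoff Q μ uR δ σ τ) - γ‖ ≤ ε}

end Dynamic

/-! ### The static persuasion model with partial commitment -/

section Static

variable {Ω M A : Type*} [Fintype Ω] [Fintype M] [Fintype A]

/-- The Bayes-plausible collections of posterior beliefs `p m` with weights `l`. -/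
def bayesPlausible (π : stdSimplex ℝ Ω) (l : stdSimplex ℝ M) : Set (M → stdSimplex ℝ Ω) :=
  {p | ∀ ω, ∑ m, l m * p m ω = π ω}

/-- The best responses of the receiver at belief `p`. -/
def bestResponses (uR : Ω → A → ℝ) (p : stdSimplex ℝ Ω) : Set A :=
  {a | ∀ b, ∑ ω, p ω * uR ω b ≤ ∑ ω, p ω * uR ω a}

/-- The expected payoff from the posteriors `p` with weights `l` and the response rule `κ`. -/
def staticPayoff (u : Ω → A → ℝ) (l : stdSimplex ℝ M) (p : M → stdSimplex ℝ Ω)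
    (κ : M → stdSimplex ℝ A) : ℝ :=
  ∑ m, l m * ∑ ω, p m ω * ∑ a, κ m a * u ω a

/-- `(p, κ)` is an equilibrium with prior `π` and message marginal `l`: the posteriors are Bayes
plausible, the receiver best responds to the posterior after every message of positive probability,
and the sender has no profitable deviation among the Bayes-plausible collections of posteriors
with the same weights. -/
structure IsStaticEquilibrium (uS uR : Ω → A → ℝ) (π : stdSimplex ℝ Ω) (l : stdSimplex ℝ M)
    (p : M → stdSimplex ℝ Ω) (κ : M → stdSimplex ℝ A) : Prop where
  plausible : p ∈ bayesPlausible π l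
  receiver : ∀ m, 0 < l m → ∀ a, 0 < κ m a → a ∈ bestResponses uR (p m)
  sender : ∀ p' ∈ bayesPlausible π l,
    0 ≤ ∑ m, l m * ∑ ω, (p m ω - p' m ω) * ∑ a, κ m a * uS ω a

/-- The set of equilibrium payoffs (sender, receiver) with prior `π` and message marginal `l`. -/
def staticEquilibriumPayoffs (uS uR : Ω → A → ℝ) (π : stdSimplex ℝ Ω) (l : stdSimplex ℝ M) :
    Set (ℝ × ℝ) :=
  {e | ∃ (p : M → stdSimplex ℝ Ω) (κ : M → stdSimplex ℝ A),
    IsStaticEquilibrium uS uR π l p κ ∧ e = (staticPayoff uS l p κ, staticPayoff uR l p κ)}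

end Static

end Persuasion

/-!
The static equilibrium is replicated by a sender whose messages reveal nothing beyond the current
posterior, against a receiver who polices the frequencies of the messages.

*The sender's strategy.* An irreducible pseudo-renewal chain keeps its state with probability
`1 - b` and redraws it from `μ` with probability `b > 0` (`exists_isRenewal`). The sender lets the
message follow the renewals: he keeps the message when the state is kept, and upon a renewal draws
the pair (state, message) from its joint law `l m * p m ω`. If the conditional law of the state
given all past messages is `p` of the last message, then both kinds of transition preserve this
property. Hence past messages carry no information beyond the current one, and the receiver can do
no better than to respond to the posterior (`abs_playExp_belief_le`,
`expectedStagePayoff_renewalSender_le`).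

*The receiver's strategy.* The receiver follows the response rule `κ` as long as the cumulated
frequency of every message stays close to its prescribed value at a sparse set of test dates; after
a failed test he responds forever to fictitious messages drawn from the prescribed marginal. Thus
the effective messages have nearly the right frequencies whatever the sender does
(`abs_effectiveDiscrepancy_le`), while the states have the invariant law. The average joint law of
states and effective messages is therefore nearly a competitor in the sender's static problem, and a
correction of its message marginal bounds the sender's payoff
(`IsStaticEquilibrium.sum_le`, `sum_expectedStagePayoff_testReceiver_le`). On the equilibrium path
the messages are geometrically mixing, so that by Chebyshev's inequality a test is ever failed only
with a small probability (`playExp_triggered_le`).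

*Convex combinations.* Several equilibria are played in turn, in long phases with the right
frequencies. At the beginning of a phase the sender draws the message independently of the state;
the receiver's belief is then wrong only until the next renewal, at a bounded cost per phase.

All estimates are made for undiscounted sums of stage payoffs, with errors at most `ε * N + c` at
every horizon `N`; summation by parts turns them into bounds for all discount factors close to one
(`mem_uniformEquilibriumPayoffs_of_sums`).
-/

namespace Persuasion

open Finset

/-! ### Distributions on finite sets -/

section Simplex

variable {X Y : Type*} [Fintype X] [Fintype Y]

/-- The weights `w`, rescaled to a distribution; if `w` is not a non-zero family of non-negative
weights, the value is the default distribution `d`. -/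
noncomputable def normalize (w : X → ℝ) (d : stdSimplex ℝ X) : stdSimplex ℝ X := by
  classical
  exact if h : (∀ x, 0 ≤ w x) ∧ 0 < ∑ x, w x then
    ⟨fun x => w x / ∑ y, w y, fun x => div_nonneg (h.1 x) h.2.le, by
      rw [← Finset.sum_div, div_self h.2.ne']⟩
  else d

theorem sum_mul_normalize {w : X → ℝ} (hw : ∀ x, 0 ≤ w x) (d : stdSimplex ℝ X) (x : X) :
    (∑ y, w y) * normalize w d x = w x := by
  rcases (Finset.sum_nonneg fun y _ => hw y).eq_or_lt with h | h
  · rw [← h, zero_mul]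
    exact ((Finset.sum_eq_zero_iff_of_nonneg fun y _ => hw y).1 h.symm x (mem_univ x)).symm
  · have : normalize w d x = w x / ∑ y, w y := by
      unfold normalize
      rw [dif_pos ⟨hw, h⟩]
      rfl
    rw [this]
    field_simp

/-- The mixture of the distributions `κ x` with weights `y`. -/
noncomputable def mix (y : stdSimplex ℝ X) (κ : X → stdSimplex ℝ Y) : stdSimplex ℝ Y :=
  ⟨fun a => ∑ x, y x * κ x a,
    fun a => Finset.sum_nonneg fun x _ =>
      mul_nonneg (stdSimplex.zero_le y x) (stdSimplex.zero_le (κ x) a), by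
      rw [Finset.sum_comm]
      simp [← Finset.mul_sum, stdSimplex.sum_eq_one]⟩

theorem mix_apply (y : stdSimplex ℝ X) (κ : X → stdSimplex ℝ Y) (a : Y) :
    mix y κ a = ∑ x, y x * κ x a := rfl

theorem sum_simplex_mul_const (y : stdSimplex ℝ X) (c : ℝ) : ∑ x, y x * c = c := by
  rw [← Finset.sum_mul, stdSimplex.sum_eq_one, one_mul]

theorem abs_sum_simplex_mul_le (y : stdSimplex ℝ X) {f : X → ℝ} {B : ℝ} (hf : ∀ x, |f x| ≤ B) :
    |∑ x, y x * f x| ≤ B := by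
  calc |∑ x, y x * f x| ≤ ∑ x, |y x * f x| := Finset.abs_sum_le_sum_abs _ _
    _ ≤ ∑ x, y x * B := by
      refine Finset.sum_le_sum fun x _ => ?_
      rw [abs_mul, abs_of_nonneg (stdSimplex.zero_le y x)]
      exact mul_le_mul_of_nonneg_left (hf x) (stdSimplex.zero_le y x)
    _ = B := sum_simplex_mul_const y B

end Simplex

/-! ### Expectations over histories of play -/

section PlayExp

variable {Ω M A : Type*} [Fintype Ω] [Fintype M] [Fintype A]
variable (Q : Matrix Ω Ω ℝ) (μ : stdSimplex ℝ Ω)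

/-- The expectation of a function of the first `n` periods of play. -/
noncomputable def playExp (σ : SenderStrategy Ω M) (τ : ReceiverStrategy M A) (n : ℕ)
    (f : (Fin n → Ω × M × A) → ℝ) : ℝ :=
  ∑ h, playProb Q μ σ τ n h * f h

variable {Q μ} {σ : SenderStrategy Ω M} {τ : ReceiverStrategy M A}

theorem expectedStagePayoff_eq_playExp (u : Ω → A → ℝ) (n : ℕ) :
    expectedStagePayoff Q μ u σ τ n =
      playExp Q μ σ τ (n + 1) fun h => u (h (Fin.last n)).1 (h (Fin.last n)).2.2 := rfl

theorem playExp_zero (f : (Fin 0 → Ω × M × A) → ℝ) : playExp Q μ σ τ 0 f = f Fin.elim0 := by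
  unfold playExp
  rw [Fintype.sum_unique]
  simp only [playProb, one_mul]
  congr 1

/-- Conditioning on the past: one period is integrated out in the order state, message, action. -/
theorem playExp_succ (n : ℕ) (f : (Fin (n + 1) → Ω × M × A) → ℝ) :
    playExp Q μ σ τ (n + 1) f = playExp Q μ σ τ n fun h =>
      ∑ ω, nextStateProb Q μ n h ω * ∑ m, σ n (fun k => ((h k).1, (h k).2.1)) ω m *
        ∑ a, τ n (fun k => (h k).2) m a *
          f (Fin.snoc (α := fun _ => Ω × M × A) h (ω, m, a)) := by
  unfold playExp
  rw [← (Fin.snocEquiv fun _ : Fin (n + 1) => Ω × M × A).sum_comp, Fintype.sum_prod_type,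
    Finset.sum_comm]
  refine Finset.sum_congr rfl fun h _ => ?_
  simp only [Fintype.sum_prod_type, Finset.mul_sum]
  refine Finset.sum_congr rfl fun ω _ => Finset.sum_congr rfl fun m _ =>
    Finset.sum_congr rfl fun a _ => ?_
  simp only [Fin.snocEquiv, Equiv.coe_fn_mk, playProb, Fin.snoc_castSucc, Fin.snoc_last]
  ring_nf

theorem playExp_add (n : ℕ) (f g : (Fin n → Ω × M × A) → ℝ) :
    playExp Q μ σ τ n (fun h => f h + g h) = playExp Q μ σ τ n f + playExp Q μ σ τ n g := by
  simp only [playExp, mul_add, Finset.sum_add_distrib]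

theorem playExp_sub (n : ℕ) (f g : (Fin n → Ω × M × A) → ℝ) :
    playExp Q μ σ τ n (fun h => f h - g h) = playExp Q μ σ τ n f - playExp Q μ σ τ n g := by
  simp only [playExp, mul_sub, Finset.sum_sub_distrib]

theorem playExp_const_mul (n : ℕ) (c : ℝ) (f : (Fin n → Ω × M × A) → ℝ) :
    playExp Q μ σ τ n (fun h => c * f h) = c * playExp Q μ σ τ n f := by
  simp only [playExp, Finset.mul_sum]
  exact Finset.sum_congr rfl fun h _ => by ring

theorem playExp_mul_const (n : ℕ) (c : ℝ) (f : (Fin n → Ω × M × A) → ℝ) :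
    playExp Q μ σ τ n (fun h => f h * c) = playExp Q μ σ τ n f * c := by
  simp only [mul_comm _ c, playExp_const_mul]

theorem playExp_sum {X : Type*} (s : Finset X) (n : ℕ) (f : X → (Fin n → Ω × M × A) → ℝ) :
    playExp Q μ σ τ n (fun h => ∑ x ∈ s, f x h) = ∑ x ∈ s, playExp Q μ σ τ n (f x) := by
  simp only [playExp, Finset.mul_sum]
  rw [Finset.sum_comm]

/-- Whatever the strategies, the current state is distributed according to the invariant
distribution. -/
theorem playExp_state (hμ : IsInvariantDist Q μ) (n : ℕ) (g : Ω → ℝ) :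
    playExp Q μ σ τ (n + 1) (fun h => g (h (Fin.last n)).1) = ∑ ω, μ ω * g ω := by
  induction n generalizing g with
  | zero =>
    rw [playExp_succ]
    simp only [Fin.snoc_last, sum_simplex_mul_const, playExp_zero, nextStateProb]
  | succ n ih =>
    rw [playExp_succ]
    simp only [Fin.snoc_last, sum_simplex_mul_const, nextStateProb]
    rw [ih fun ω => ∑ ω', Q ω ω' * g ω']
    simp only [Finset.mul_sum]
    rw [Finset.sum_comm]
    refine Finset.sum_congr rfl fun ω' _ => ?_
    rw [← hμ ω', Finset.sum_mul]
    exact Finset.sum_congr rfl fun ω _ => by ring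

section Stochastic

variable [DecidableEq Ω] (hQ : Q ∈ Matrix.rowStochastic ℝ Ω)
include hQ

omit [Fintype M] [Fintype A] in
theorem nextStateProb_nonneg (n : ℕ) (h : Fin n → Ω × M × A) (ω : Ω) :
    0 ≤ nextStateProb Q μ n h ω := by
  cases n with
  | zero => exact stdSimplex.zero_le μ ω
  | succ n => exact Matrix.nonneg_of_mem_rowStochastic hQ

omit [Fintype M] [Fintype A] in
theorem sum_nextStateProb (n : ℕ) (h : Fin n → Ω × M × A) :
    ∑ ω, nextStateProb Q μ n h ω = 1 := by
  cases n with
  | zero => exact stdSimplex.sum_eq_one μ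
  | succ n => exact (Matrix.mem_rowStochastic_iff_sum.1 hQ).2 _

theorem playProb_nonneg : ∀ (n : ℕ) (h : Fin n → Ω × M × A), 0 ≤ playProb Q μ σ τ n h
  | 0, _ => zero_le_one
  | n + 1, _ => mul_nonneg (mul_nonneg (mul_nonneg (playProb_nonneg n _)
      (nextStateProb_nonneg hQ n _ _)) (stdSimplex.zero_le _ _)) (stdSimplex.zero_le _ _)

theorem playExp_mono {n : ℕ} {f g : (Fin n → Ω × M × A) → ℝ} (hfg : ∀ h, f h ≤ g h) :
    playExp Q μ σ τ n f ≤ playExp Q μ σ τ n g :=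
  Finset.sum_le_sum fun h _ => mul_le_mul_of_nonneg_left (hfg h) (playProb_nonneg hQ n h)

theorem playExp_init (n : ℕ) (f : (Fin n → Ω × M × A) → ℝ) :
    playExp Q μ σ τ (n + 1) (fun h => f (Fin.init h)) = playExp Q μ σ τ n f := by
  rw [playExp_succ]
  simp only [Fin.init_snoc, sum_simplex_mul_const]
  congr 1
  funext h
  rw [← Finset.sum_mul, sum_nextStateProb hQ, one_mul]

theorem playExp_const (n : ℕ) (c : ℝ) : playExp Q μ σ τ n (fun _ => c) = c := by
  induction n with
  | zero => rw [playExp_zero]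
  | succ n ih => rw [playExp_init hQ n fun _ => c, ih]

theorem abs_playExp_le {n : ℕ} {f : (Fin n → Ω × M × A) → ℝ} {B : ℝ} (hf : ∀ h, |f h| ≤ B) :
    |playExp Q μ σ τ n f| ≤ B := by
  rw [abs_le]
  constructor
  · rw [← playExp_const (σ := σ) (τ := τ) (μ := μ) hQ n (-B)]
    exact playExp_mono hQ fun h => (abs_le.1 (hf h)).1
  · rw [← playExp_const (σ := σ) (τ := τ) (μ := μ) hQ n B]
    exact playExp_mono hQ fun h => (abs_le.1 (hf h)).2

theorem playExp_nonneg {n : ℕ} {f : (Fin n → Ω × M × A) → ℝ} (hf : ∀ h, 0 ≤ f h) :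
    0 ≤ playExp Q μ σ τ n f :=
  Finset.sum_nonneg fun h _ => mul_nonneg (playProb_nonneg hQ n h) (hf h)

end Stochastic

end PlayExp

/-! ### From undiscounted sums to discounted payoffs -/

section Discounting

/-- Summation by parts: a linear bound on all partial sums bounds the discounted sums. -/
theorem discounted_tsum_le {x : ℕ → ℝ} {a B c δ : ℝ} (hx : ∀ n, |x n| ≤ B)
    (hs : ∀ N : ℕ, ∑ n ∈ range N, x n ≤ a * N + c) (hδ0 : 0 ≤ δ) (hδ1 : δ < 1) :
    (1 - δ) * ∑' n, δ ^ n * x n ≤ a + c * (1 - δ) := by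
  have key : ∀ N : ℕ, ∑ n ∈ range N, δ ^ n * (x n - a)
      + δ ^ N * (c - ∑ n ∈ range N, (x n - a)) ≤ c := by
    intro N
    induction N with
    | zero => simp
    | succ N ih =>
      have h1 : 0 ≤ c - ∑ n ∈ range (N + 1), (x n - a) := by
        have := hs (N + 1)
        rw [Finset.sum_sub_distrib, Finset.sum_const, card_range, nsmul_eq_mul]
        linarith
      have h2 : 0 ≤ δ ^ N * (1 - δ) := mul_nonneg (pow_nonneg hδ0 N) (by linarith)
      have h3 := mul_nonneg h2 h1
      rw [Finset.sum_range_succ] at h3 ⊢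
      rw [Finset.sum_range_succ (fun n => x n - a), pow_succ]
      linarith
  have hle : ∀ N : ℕ, ∑ n ∈ range N, δ ^ n * (x n - a) ≤ c := by
    intro N
    have h1 : 0 ≤ c - ∑ n ∈ range N, (x n - a) := by
      have := hs N
      rw [Finset.sum_sub_distrib, Finset.sum_const, card_range, nsmul_eq_mul]
      linarith
    have := mul_nonneg (pow_nonneg hδ0 N) h1
    linarith [key N]
  have hgeo := summable_geometric_of_lt_one hδ0 hδ1
  have hsx : Summable fun n => δ ^ n * x n := by
    refine Summable.of_norm_bounded (hgeo.mul_right B) fun n => ?_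
    rw [Real.norm_eq_abs, abs_mul, abs_of_nonneg (pow_nonneg hδ0 n)]
    exact mul_le_mul_of_nonneg_left (hx n) (pow_nonneg hδ0 n)
  have hsa : Summable fun n => δ ^ n * a := hgeo.mul_right a
  have hlim : ∑' n, δ ^ n * (x n - a) ≤ c := by
    have hs' : Summable fun n => δ ^ n * (x n - a) := by
      simpa only [mul_sub] using hsx.sub hsa
    exact le_of_tendsto' hs'.hasSum.tendsto_sum_nat hle
  have hsplit : ∑' n, δ ^ n * (x n - a) = ∑' n, δ ^ n * x n - (1 - δ)⁻¹ * a := by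
    simp only [mul_sub]
    rw [hsx.tsum_sub hsa, tsum_mul_right, tsum_geometric_of_lt_one hδ0 hδ1]
  have h1 : 0 < 1 - δ := by linarith
  rw [hsplit] at hlim
  calc (1 - δ) * ∑' n, δ ^ n * x n ≤ (1 - δ) * (c + (1 - δ)⁻¹ * a) :=
        mul_le_mul_of_nonneg_left (by linarith) h1.le
    _ = a + c * (1 - δ) := by field_simp; ring

variable {Ω M A : Type*} [Fintype Ω] [DecidableEq Ω] [Fintype M] [Fintype A]
variable {Q : Matrix Ω Ω ℝ} {μ : stdSimplex ℝ Ω}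

omit [DecidableEq Ω] in
theorem exists_abs_le (u : Ω → A → ℝ) : ∃ B, ∀ ω a, |u ω a| ≤ B := by
  refine ⟨∑ ω, ∑ a, |u ω a|, fun ω a => ?_⟩
  calc |u ω a| ≤ ∑ a, |u ω a| := single_le_sum (f := fun a => |u ω a|)
        (fun _ _ => abs_nonneg _) (mem_univ a)
    _ ≤ _ := single_le_sum (f := fun ω => ∑ a, |u ω a|)
        (fun _ _ => Finset.sum_nonneg fun _ _ => abs_nonneg _) (mem_univ ω)

theorem discountedPayoff_le (hQ : Q ∈ Matrix.rowStochastic ℝ Ω) {u : Ω → A → ℝ}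
    {σ : SenderStrategy Ω M} {τ : ReceiverStrategy M A} {a c δ : ℝ}
    (hs : ∀ N : ℕ, ∑ n ∈ range N, expectedStagePayoff Q μ u σ τ n ≤ a * N + c)
    (hδ0 : 0 ≤ δ) (hδ1 : δ < 1) :
    discountedPayoff Q μ u δ σ τ ≤ a + c * (1 - δ) := by
  obtain ⟨B, hB⟩ := exists_abs_le u
  exact discounted_tsum_le (B := B) (fun n => abs_playExp_le hQ fun h => hB _ _) hs hδ0 hδ1

theorem le_discountedPayoff (hQ : Q ∈ Matrix.rowStochastic ℝ Ω) {u : Ω → A → ℝ}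
    {σ : SenderStrategy Ω M} {τ : ReceiverStrategy M A} {a c δ : ℝ}
    (hs : ∀ N : ℕ, a * N - c ≤ ∑ n ∈ range N, expectedStagePayoff Q μ u σ τ n)
    (hδ0 : 0 ≤ δ) (hδ1 : δ < 1) :
    a - c * (1 - δ) ≤ discountedPayoff Q μ u δ σ τ := by
  obtain ⟨B, hB⟩ := exists_abs_le u
  have := discounted_tsum_le (x := fun n => -expectedStagePayoff Q μ u σ τ n) (B := B)
    (a := -a) (c := c)
    (fun n => by rw [abs_neg]; exact abs_playExp_le hQ fun h => hB _ _)
    (fun N => by rw [Finset.sum_neg_distrib]; linarith [hs N]) hδ0 hδ1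
  simp only [mul_neg, tsum_neg] at this
  unfold discountedPayoff
  linarith

/-- It suffices to control undiscounted sums of stage payoffs, up to a slack that is a small
multiple of the horizon plus a constant. The upper bounds on the equilibrium payoffs are the
deviation bounds applied to the equilibrium strategies. -/
theorem mem_uniformEquilibriumPayoffs_of_sums (hQ : Q ∈ Matrix.rowStochastic ℝ Ω)
    {uS uR : Ω → A → ℝ} {γ : ℝ × ℝ}
    (H : ∀ ε : ℝ, 0 < ε → ∃ (σ : SenderStrategy Ω M) (τ : ReceiverStrategy M A) (c : ℝ),
      (∀ (σ' : SenderStrategy Ω M) (N : ℕ),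
        ∑ n ∈ range N, expectedStagePayoff Q μ uS σ' τ n ≤ (γ.1 + ε) * N + c) ∧
      (∀ (τ' : ReceiverStrategy M A) (N : ℕ),
        ∑ n ∈ range N, expectedStagePayoff Q μ uR σ τ' n ≤ (γ.2 + ε) * N + c) ∧
      (∀ N : ℕ, (γ.1 - ε) * N - c ≤ ∑ n ∈ range N, expectedStagePayoff Q μ uS σ τ n) ∧
      (∀ N : ℕ, (γ.2 - ε) * N - c ≤ ∑ n ∈ range N, expectedStagePayoff Q μ uR σ τ n)) :
    γ ∈ uniformEquilibriumPayoffs M Q μ uS uR := by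
  intro ε hε
  obtain ⟨σ, τ, c, hS, hR, hS', hR'⟩ := H (ε / 4) (by linarith)
  have hc : 0 < |c| + 1 := by positivity
  refine ⟨max (1 / 2) (1 - ε / 4 / (|c| + 1)), lt_max_of_lt_left (by norm_num),
    max_lt (by norm_num) (by have : 0 < ε / 4 / (|c| + 1) := by positivity
                             linarith), σ, τ, fun δ hδ hδ1 => ?_⟩
  have hδ0 : 0 ≤ δ := by linarith [(le_max_left _ _).trans hδ]
  have hcδ : c * (1 - δ) ≤ ε / 4 := by
    have h1 : 1 - δ ≤ ε / 4 / (|c| + 1) := by linarith [(le_max_right _ _).trans hδ]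
    calc c * (1 - δ) ≤ (|c| + 1) * (1 - δ) :=
          mul_le_mul_of_nonneg_right (by linarith [le_abs_self c]) (by linarith)
      _ ≤ (|c| + 1) * (ε / 4 / (|c| + 1)) := mul_le_mul_of_nonneg_left h1 hc.le
      _ = ε / 4 := by field_simp
  have uS' := fun σ' => discountedPayoff_le hQ (hS σ') hδ0 hδ1
  have uR' := fun τ' => discountedPayoff_le hQ (hR τ') hδ0 hδ1
  have lS := le_discountedPayoff hQ hS' hδ0 hδ1
  have lR := le_discountedPayoff hQ hR' hδ0 hδ1
  refine ⟨fun σ' => by linarith [uS' σ'], fun τ' => by linarith [uR' τ'], ?_⟩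
  rw [Prod.norm_def]
  refine max_le ?_ ?_
  · rw [Real.norm_eq_abs, abs_le]
    constructor <;> simp only [Prod.fst_sub] <;> linarith [uS' σ]
  · rw [Real.norm_eq_abs, abs_le]
    constructor <;> simp only [Prod.snd_sub] <;> linarith [uR' τ]

end Discounting

/-! ### Schedules and numerical estimates -/

section Schedule

/-- A sequence of indices that uses every index with its prescribed frequency, up to a bounded
discrepancy. An index is chosen only while it is in arrears; then no index is ever more than one
period ahead, and since the discrepancies sum to zero none is far behind. -/
theorem exists_balanced_sequence {ι : Type*} [Fintype ι] [DecidableEq ι] {α : ι → ℝ}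
    (hα : ∀ i, 0 ≤ α i) (hα1 : ∑ i, α i = 1) :
    ∃ c : ℕ → ι, ∀ (J : ℕ) (i : ι),
      |∑ j ∈ range J, ((if c j = i then (1 : ℝ) else 0) - α i)| ≤ Fintype.card ι := by
  have hne : Nonempty ι := by
    by_contra h
    rw [not_nonempty_iff] at h
    simp at hα1
  have hpick : ∀ d : ι → ℝ, ∃ i, ∑ i, d i = 1 → 0 ≤ d i := by
    intro d
    by_contra! h
    obtain ⟨i₀⟩ := hne
    have : ∑ i, d i ≤ 0 := Finset.sum_nonpos fun i _ => (h i).2.le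
    linarith [(h i₀).1]
  choose pick hpick using hpick
  let D : ℕ → ι → ℝ := fun j => Nat.rec (fun _ => 0)
    (fun _ d i => d i + α i - if pick (fun i => d i + α i) = i then 1 else 0) j
  let c : ℕ → ι := fun j => pick fun i => D j i + α i
  have hD : ∀ j i, D (j + 1) i = D j i + α i - if c j = i then 1 else 0 := fun j i => rfl
  have hsum : ∀ j, ∑ i, D j i = 0 := by
    intro j
    induction j with
    | zero => exact Finset.sum_const_zero
    | succ j ih =>
      simp only [hD, Finset.sum_sub_distrib, Finset.sum_add_distrib, ih, hα1]
      simp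
  have hlow : ∀ j i, -1 ≤ D j i := by
    intro j
    induction j with
    | zero => intro i; show (-1 : ℝ) ≤ 0; norm_num
    | succ j ih =>
      intro i
      rw [hD]
      split_ifs with h
      · have h1 : 0 ≤ D j (c j) + α (c j) := hpick (fun i => D j i + α i) (by
          rw [Finset.sum_add_distrib, hsum, hα1, zero_add])
        rw [h] at h1
        linarith
      · linarith [ih i, hα i]
  have hEq : ∀ J i, ∑ j ∈ range J, ((if c j = i then (1 : ℝ) else 0) - α i) = -D J i := by
    intro J i
    induction J with
    | zero => rw [Finset.sum_range_zero]; exact neg_zero.symm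
    | succ J ih => rw [Finset.sum_range_succ, ih, hD]; ring
  refine ⟨c, fun J i => ?_⟩
  have hcard : (1 : ℝ) ≤ Fintype.card ι := by exact_mod_cast Fintype.card_pos
  rw [hEq, abs_neg, abs_le]
  refine ⟨by linarith [hlow J i], ?_⟩
  have h0 : ∀ k ∈ univ, 0 ≤ D J k + 1 := fun k _ => by linarith [hlow J k]
  have h1 := Finset.single_le_sum h0 (mem_univ i)
  rw [Finset.sum_add_distrib, hsum] at h1
  simp at h1
  linarith

/-- Every term of the sequence `f` is repeated `L` times. -/
theorem sum_range_div {L : ℕ} (hL : 0 < L) (f : ℕ → ℝ) (N : ℕ) :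
    ∑ n ∈ range N, f (n / L) = L * ∑ j ∈ range (N / L), f j + (N % L : ℕ) * f (N / L) := by
  induction N with
  | zero => simp
  | succ N ih =>
    rw [Finset.sum_range_succ, ih]
    have h1 := Nat.div_add_mod N L
    have h2 := Nat.div_add_mod (N + 1) L
    have h3 := Nat.mod_lt N hL
    by_cases h : L ∣ N + 1
    · have hd := Nat.succ_div_of_dvd h
      have hm := Nat.mod_eq_zero_of_dvd h
      have hm' : ((N % L : ℕ) : ℝ) + 1 = L := by
        rw [hd, hm, Nat.mul_add] at h2
        exact_mod_cast (by omega : N % L + 1 = L)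
      rw [hd, hm, Finset.sum_range_succ, ← hm']
      push_cast
      ring
    · have hd := Nat.succ_div_of_not_dvd h
      have hm : (N + 1) % L = N % L + 1 := by rw [hd] at h2; omega
      rw [hd, hm]
      push_cast
      ring

theorem abs_sum_range_div_le {L : ℕ} (hL : 0 < L) {f : ℕ → ℝ} {B C : ℝ}
    (hf : ∀ j, |f j| ≤ B) (hs : ∀ J, |∑ j ∈ range J, f j| ≤ C) (N : ℕ) :
    |∑ n ∈ range N, f (n / L)| ≤ L * (C + B) := by
  rw [sum_range_div hL]
  have hB : 0 ≤ B := (abs_nonneg _).trans (hf 0)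
  have hmod : ((N % L : ℕ) : ℝ) ≤ L := by exact_mod_cast (Nat.mod_lt N hL).le
  calc _ ≤ |(L : ℝ) * ∑ j ∈ range (N / L), f j| + |((N % L : ℕ) : ℝ) * f (N / L)| := abs_add_le _ _
    _ = L * |∑ j ∈ range (N / L), f j| + (N % L : ℕ) * |f (N / L)| := by
      rw [abs_mul, abs_mul, Nat.abs_cast, Nat.abs_cast]
    _ ≤ L * C + L * B := add_le_add (mul_le_mul_of_nonneg_left (hs _) (Nat.cast_nonneg L))
      (mul_le_mul hmod (hf _) (abs_nonneg _) (Nat.cast_nonneg L))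
    _ = L * (C + B) := by ring

/-- The recursive bound on the distance between the receiver's belief and the intended one: it is
at most `2` when the sender resets, and contracts by the factor `1 - b` in every other period. -/
noncomputable def beliefError (b : ℝ) (R : ℕ → Prop) [DecidablePred R] : ℕ → ℝ
  | 0 => 2
  | n + 1 => if R (n + 1) then 2 else (1 - b) * beliefError b R n

theorem beliefError_nonneg {b : ℝ} (hb1 : b ≤ 1) (R : ℕ → Prop) [DecidablePred R] :
    ∀ n, 0 ≤ beliefError b R n
  | 0 => zero_le_two
  | n + 1 => by
    rw [beliefError]
    split_ifs
    · exact zero_le_two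
    · exact mul_nonneg (by linarith) (beliefError_nonneg hb1 R n)

theorem mul_sum_beliefError_le {b : ℝ} (hb0 : 0 ≤ b) (hb1 : b ≤ 1) (L N : ℕ) :
    b * ∑ n ∈ range N, beliefError b (fun n => L ∣ n) n ≤ 2 + 2 * (N / L) := by
  have key : ∀ N : ℕ, b * ∑ n ∈ range N, beliefError b (fun n => L ∣ n) n
      + beliefError b (fun n => L ∣ n) N ≤ 2 + 2 * (N / L : ℕ) := by
    intro N
    induction N with
    | zero => simp [beliefError]
    | succ N ih =>
      have h0 := mul_nonneg hb0 (beliefError_nonneg hb1 (fun n => L ∣ n) N)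
      have h1 := mul_nonneg (sub_nonneg.2 hb1) (beliefError_nonneg hb1 (fun n => L ∣ n) N)
      rw [Finset.sum_range_succ, beliefError, Nat.succ_div]
      split_ifs
      · push_cast
        linarith
      · rw [add_zero]
        linarith
  have h1 : ((N / L : ℕ) : ℝ) ≤ N / L := Nat.cast_div_le
  linarith [key N, beliefError_nonneg hb1 (fun n => L ∣ n) N]

/-- The reciprocals of the squares of the integers from `K` on have sum at most `2 / K`. -/
theorem sum_inv_squares_le {K : ℕ} (hK : 0 < K) (n : ℕ) :
    ∑ j ∈ range n, (if IsSquare j ∧ K ^ 2 ≤ j then (j : ℝ)⁻¹ else 0) ≤ 2 / K := by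
  rw [← Finset.sum_filter]
  have hsub : (range n).filter (fun j => IsSquare j ∧ K ^ 2 ≤ j)
      ⊆ (Ioo (K - 1) (n + 1)).image (fun k => k ^ 2) := by
    intro j hj
    simp only [Finset.mem_filter, Finset.mem_range] at hj
    obtain ⟨hjn, ⟨r, rfl⟩, hKr⟩ := hj
    rw [Finset.mem_image]
    refine ⟨r, ?_, sq r⟩
    rw [Finset.mem_Ioo]
    have h1 : K ≤ r := by
      rw [← sq] at hKr
      exact (Nat.pow_le_pow_iff_left two_ne_zero).1 hKr
    have h2 : r ≤ r * r := Nat.le_mul_self r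
    omega
  calc _ ≤ ∑ j ∈ (Ioo (K - 1) (n + 1)).image (fun k : ℕ => k ^ 2), ((j : ℕ) : ℝ)⁻¹ :=
        Finset.sum_le_sum_of_subset_of_nonneg hsub fun _ _ _ => by positivity
    _ = ∑ k ∈ Ioo (K - 1) (n + 1), ((k : ℝ) ^ 2)⁻¹ := by
      rw [Finset.sum_image fun a _ b _ hab => Nat.pow_left_injective two_ne_zero hab]
      simp only [Nat.cast_pow]
    _ ≤ 2 / ((K - 1 : ℕ) + 1) := sum_Ioo_inv_sq_le (K - 1) (n + 1)
    _ = 2 / K := by rw [Nat.cast_sub hK]; simp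

end Schedule

/-! ### Stability of the sender's static problem -/

section Coupling

variable {Ω M A : Type*} [Fintype Ω] [Fintype M] [Fintype A]

/-- The sender's equilibrium payoff is, up to a linear error, an upper bound for every joint
law `j` of states and messages whose state marginal is right and whose message marginal is nearly
right. The law `j` is turned into one with exact marginals: the rows with too much mass are scaled
down and the released mass is spread over the other rows. -/
theorem IsStaticEquilibrium.sum_le {uS uR : Ω → A → ℝ} {π : stdSimplex ℝ Ω} {l : stdSimplex ℝ M}
    {p : M → stdSimplex ℝ Ω} {κ : M → stdSimplex ℝ A} (heq : IsStaticEquilibrium uS uR π l p κ)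
    {B : ℝ} (hB : ∀ ω a, |uS ω a| ≤ B) {W e : ℝ} (hW : 0 ≤ W) {j : Ω → M → ℝ}
    (hj : ∀ ω m, 0 ≤ j ω m) (hjΩ : ∀ ω, ∑ m, j ω m = W * π ω)
    (hjM : ∀ m, |∑ ω, j ω m - W * l m| ≤ e) :
    ∑ ω, ∑ m, j ω m * ∑ a, κ m a * uS ω a ≤
      W * staticPayoff uS l p κ + 2 * B * Fintype.card M * e := by
  set v : Ω → M → ℝ := fun ω m => ∑ a, κ m a * uS ω a with hv
  have hvB : ∀ ω m, |v ω m| ≤ B := fun ω m => abs_sum_simplex_mul_le (κ m) (hB ω)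
  set J : M → ℝ := fun m => ∑ ω, j ω m with hJ
  have hJ0 : ∀ m, 0 ≤ J m := fun m => Finset.sum_nonneg fun ω _ => hj ω m
  -- the factor by which row `m` is scaled down
  set s : M → ℝ := fun m => if J m ≤ W * l m then 1 else W * l m / J m with hs
  have hWl : ∀ m, 0 ≤ W * l m := fun m => mul_nonneg hW (stdSimplex.zero_le l m)
  have hs0 : ∀ m, 0 ≤ s m := fun m => by
    simp only [hs]; split_ifs
    · exact zero_le_one
    · exact div_nonneg (hWl m) (hJ0 m)
  have hs1 : ∀ m, s m ≤ 1 := fun m => by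
    simp only [hs]; split_ifs with h
    · exact le_rfl
    · push Not at h
      exact div_le_one_of_le₀ h.le (hJ0 m)
  have hsJ : ∀ m, s m * J m = min (J m) (W * l m) := fun m => by
    simp only [hs]; split_ifs with h
    · rw [min_eq_left h, one_mul]
    · push Not at h
      rw [min_eq_right h.le, div_mul_cancel₀]
      exact ((hWl m).trans_lt h).ne'
  -- the released mass and the missing mass
  set r : Ω → ℝ := fun ω => W * π ω - ∑ m, s m * j ω m with hr
  set d : M → ℝ := fun m => W * l m - s m * J m with hd
  have hr' : ∀ ω, r ω = ∑ m, (1 - s m) * j ω m := fun ω => by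
    simp only [hr, ← hjΩ, sub_mul, one_mul, Finset.sum_sub_distrib]
  have hr0 : ∀ ω, 0 ≤ r ω := fun ω => by
    rw [hr']
    exact Finset.sum_nonneg fun m _ => mul_nonneg (by linarith [hs1 m]) (hj ω m)
  have hd0 : ∀ m, 0 ≤ d m := fun m => by
    simp only [hd, hsJ]; linarith [min_le_right (J m) (W * l m)]
  set ρ : ℝ := ∑ ω, r ω with hρ
  have hρd : ∑ m, d m = ρ := by
    simp only [hρ, hr, hd, Finset.sum_sub_distrib, ← Finset.mul_sum, stdSimplex.sum_eq_one]
    rw [Finset.sum_comm]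
    simp only [hJ, ← Finset.mul_sum]
  have hρ0 : 0 ≤ ρ := Finset.sum_nonneg fun ω _ => hr0 ω
  have hρe : ρ ≤ Fintype.card M * e := by
    rw [← hρd]
    calc ∑ m, d m ≤ ∑ _m : M, e := by
          refine Finset.sum_le_sum fun m _ => ?_
          have h1 := abs_le.1 (hjM m)
          have h2 : (0 : ℝ) ≤ e := (abs_nonneg _).trans (hjM m)
          simp only [hd, hsJ]
          rcases min_choice (J m) (W * l m) with h | h <;> rw [h]
          · linarith [h1.1]
          · linarith
      _ = _ := by simp
  have hrd : ∀ ω, ∑ m, r ω * d m / ρ = r ω := fun ω => by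
    rw [← Finset.sum_div, ← Finset.mul_sum, hρd]
    rcases hρ0.eq_or_lt with h | h
    · have := (Finset.sum_eq_zero_iff_of_nonneg fun ω _ => hr0 ω).1 h.symm ω (mem_univ ω)
      rw [this]; simp
    · field_simp
  have hdr : ∀ m, ∑ ω, r ω * d m / ρ = d m := fun m => by
    rw [← Finset.sum_div, ← Finset.sum_mul, ← hρ]
    rcases hρ0.eq_or_lt with h | h
    · have := (Finset.sum_eq_zero_iff_of_nonneg fun m _ => hd0 m).1 (hρd.trans h.symm) m
        (mem_univ m)
      rw [this]; simp
    · field_simp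
  -- the corrected joint law, with exact marginals
  set j' : M → Ω → ℝ := fun m ω => s m * j ω m + r ω * d m / ρ with hj'
  have hj'0 : ∀ m ω, 0 ≤ j' m ω := fun m ω =>
    add_nonneg (mul_nonneg (hs0 m) (hj ω m)) (div_nonneg (mul_nonneg (hr0 ω) (hd0 m)) hρ0)
  have hj'M : ∀ m, ∑ ω, j' m ω = W * l m := fun m => by
    rw [Finset.sum_add_distrib, ← Finset.mul_sum, hdr]
    exact add_sub_cancel (s m * J m) (W * l m)
  have hj'Ω : ∀ ω, ∑ m, j' m ω = W * π ω := fun ω => by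
    rw [Finset.sum_add_distrib, hrd]
    exact add_sub_cancel (∑ m, s m * j ω m) (W * π ω)
  have hmain : ∑ ω, ∑ m, j' m ω * v ω m ≤ W * staticPayoff uS l p κ := by
    rcases hW.eq_or_lt with h | h
    · have : ∀ m ω, j' m ω = 0 := fun m ω => by
        have h1 := hj'M m
        rw [← h, zero_mul] at h1
        exact (Finset.sum_eq_zero_iff_of_nonneg fun ω _ => hj'0 m ω).1 h1 ω (mem_univ ω)
      simp [this, ← h]
    · set p' : M → stdSimplex ℝ Ω := fun m => normalize (j' m) π with hp'
      have hpj : ∀ m ω, W * (l m * p' m ω) = j' m ω := fun m ω => by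
        rw [← mul_assoc, ← hj'M m]
        exact sum_mul_normalize (hj'0 m) π ω
      have hbp : p' ∈ bayesPlausible π l := fun ω => by
        have := hj'Ω ω
        simp only [← hpj, ← Finset.mul_sum] at this
        exact mul_left_cancel₀ h.ne' this
      have hopt := heq.sender p' hbp
      have hsplit : ∑ m, l m * ∑ ω, (p m ω - p' m ω) * ∑ a, κ m a * uS ω a
          = staticPayoff uS l p κ - ∑ m, ∑ ω, l m * p' m ω * v ω m := by
        simp only [staticPayoff, sub_mul, Finset.sum_sub_distrib, mul_sub, hv, Finset.mul_sum,
          mul_assoc]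
      have : ∑ ω, ∑ m, j' m ω * v ω m = W * ∑ m, ∑ ω, l m * p' m ω * v ω m := by
        rw [Finset.sum_comm]
        simp only [← hpj, Finset.mul_sum, mul_assoc]
      rw [this]
      exact mul_le_mul_of_nonneg_left (by linarith) hW
  have hdiff : ∑ ω, ∑ m, j ω m * v ω m - ∑ ω, ∑ m, j' m ω * v ω m ≤ 2 * B * ρ := by
    have hpt : ∀ ω m, j ω m * v ω m - j' m ω * v ω m
        ≤ B * ((1 - s m) * j ω m) + B * (r ω * d m / ρ) := fun ω m => by
      have h1 : 0 ≤ (1 - s m) * j ω m := mul_nonneg (by linarith [hs1 m]) (hj ω m)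
      have h2 : 0 ≤ r ω * d m / ρ := div_nonneg (mul_nonneg (hr0 ω) (hd0 m)) hρ0
      have h3 := abs_le.1 (hvB ω m)
      have h4 := mul_le_mul_of_nonneg_right h3.2 h1
      have h5 := mul_le_mul_of_nonneg_right h3.1 h2
      simp only [hj']
      nlinarith
    calc _ = ∑ ω, ∑ m, (j ω m * v ω m - j' m ω * v ω m) := by
          simp only [Finset.sum_sub_distrib]
      _ ≤ ∑ ω, ∑ m, (B * ((1 - s m) * j ω m) + B * (r ω * d m / ρ)) :=
        Finset.sum_le_sum fun ω _ => Finset.sum_le_sum fun m _ => hpt ω m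
      _ = 2 * B * ρ := by
        simp only [Finset.sum_add_distrib, ← Finset.mul_sum, hrd, ← hr', ← hρ]
        ring
  rcases isEmpty_or_nonempty M with hM | ⟨⟨m₀⟩⟩
  · simpa [hv] using hmain
  · have hΩ : 0 ≤ B := by
      rcases isEmpty_or_nonempty Ω with hΩ | ⟨⟨ω₀⟩⟩
      · have := stdSimplex.sum_eq_one π
        simp at this
      · exact (abs_nonneg _).trans (hvB ω₀ m₀)
    have := mul_le_mul_of_nonneg_left hρe (by linarith : 0 ≤ 2 * B)
    linarith

end Coupling

/-! ### The sender's strategy and the receiver's beliefs -/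

section Renewal

variable {Ω M A ι : Type*} [Fintype Ω] [Fintype M] [Fintype A]

/-- In every period the state is, with probability `b`, drawn anew from `μ`, and otherwise kept. The
property is stated through the transition operator. -/
def IsRenewal (Q : Matrix Ω Ω ℝ) (μ : stdSimplex ℝ Ω) (b : ℝ) : Prop :=
  ∀ (g : Ω → ℝ) (ω : Ω), ∑ ω', Q ω ω' * g ω' = (1 - b) * g ω + b * ∑ ω', μ ω' * g ω'

/-- An irreducible pseudo-renewal chain is a renewal chain: the renewal probability is the sum of
the numbers `β`, and invariance identifies `β / ∑ β` with `μ`. -/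
theorem exists_isRenewal [DecidableEq Ω] {Q : Matrix Ω Ω ℝ} (hQ : Q ∈ Matrix.rowStochastic ℝ Ω)
    (hirr : Q.IsIrreducible) (hpr : IsPseudoRenewal Q) {μ : stdSimplex ℝ Ω}
    (hμ : IsInvariantDist Q μ) : ∃ b : ℝ, 0 < b ∧ b ≤ 1 ∧ IsRenewal Q μ b := by
  obtain ⟨β, hβ0, hβ1, hβ⟩ := hpr
  rcases subsingleton_or_nontrivial Ω with hΩ | hΩ
  · -- with a single state `β` is unconstrained, and any `b` will do
    refine ⟨1, one_pos, le_rfl, fun g ω => ?_⟩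
    have hg : ∀ ω', g ω' = g ω := fun ω' => by rw [Subsingleton.elim ω' ω]
    simp only [hg]
    rw [sum_simplex_mul_const, ← Finset.sum_mul, (Matrix.mem_rowStochastic_iff_sum.1 hQ).2 ω]
    ring
  · have hQ' : ∀ ω ω', Q ω ω' = (1 - ∑ x, β x) * (if ω = ω' then 1 else 0) + β ω' := by
      intro ω ω'
      split_ifs with h
      · subst h
        have h1 := (Matrix.mem_rowStochastic_iff_sum.1 hQ).2 ω
        rw [← Finset.add_sum_erase _ _ (mem_univ ω)] at h1 ⊢
        rw [Finset.sum_congr rfl fun x hx => hβ x ω (Finset.ne_of_mem_erase hx)] at h1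
        linarith
      · rw [hβ ω' ω (Ne.symm h)]
        ring
    have hb0 : 0 ≤ ∑ x, β x := Finset.sum_nonneg fun x _ => hβ0 x
    have hb : 0 < ∑ x, β x := by
      refine hb0.lt_of_ne fun h => ?_
      have hz : ∀ x, β x = 0 := fun x =>
        (Finset.sum_eq_zero_iff_of_nonneg fun x _ => hβ0 x).1 h.symm x (mem_univ x)
      have hQ1 : Q = 1 := by
        ext ω ω'
        rw [hQ', ← h, hz, Matrix.one_apply]
        ring
      obtain ⟨x, y, hxy⟩ := exists_pair_ne Ω
      obtain ⟨k, -, hk⟩ := (Matrix.isIrreducible_iff_exists_pow_pos fun i j =>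
        Matrix.nonneg_of_mem_rowStochastic hQ).1 hirr x y
      rw [hQ1, one_pow, Matrix.one_apply_ne hxy] at hk
      exact lt_irrefl _ hk
    have hμβ : ∀ ω, (∑ x, β x) * μ ω = β ω := by
      intro ω
      have h1 := hμ ω
      simp only [hQ', mul_add, Finset.sum_add_distrib] at h1
      rw [sum_simplex_mul_const] at h1
      simp only [mul_ite, mul_one, mul_zero, Finset.sum_ite_eq', mem_univ, if_true] at h1
      linarith
    refine ⟨∑ x, β x, hb, hβ1, fun g ω => ?_⟩
    rw [Finset.mul_sum univ fun ω' => μ ω' * g ω']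
    simp only [← mul_assoc, hμβ]
    simp only [hQ', add_mul, Finset.sum_add_distrib]
    simp

/-- The strategy of the sender for the schedule `i` of equilibria with message marginals `l` and
posteriors `p`. In the periods in `R` the message is drawn from the current marginal, independently
of the state. In all other periods the message follows the renewals of the state: given the renewal,
the pair (state, message) is drawn from its joint law in the current equilibrium, and otherwise the
previous message is repeated. Renewals to the same state are unobservable, so the sender draws from
the conditional law of the message given the two states. -/
noncomputable def renewalSender (b : ℝ) (l : ι → stdSimplex ℝ M) (p : ι → M → stdSimplex ℝ Ω)
    (i : ℕ → ι) (R : ℕ → Prop) [DecidablePred R] : SenderStrategy Ω M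
  | 0, _, _ => l (i 0)
  | n + 1, h, ω =>
    if R (n + 1) then l (i (n + 1))
    else normalize (fun m => (1 - b) * ({h (Fin.last n)} : Set (Ω × M)).indicator 1 (ω, m)
      + b * (l (i (n + 1)) m * p (i (n + 1)) m ω)) (l (i (n + 1)))

variable {Q : Matrix Ω Ω ℝ} {μ : stdSimplex ℝ Ω} {b : ℝ}

/-- In a period without reset, the pair (state, message) is kept with probability `1 - b` and drawn
anew from its equilibrium law with probability `b`. -/
theorem IsRenewal.sum_mul_normalize (hren : IsRenewal Q μ b) (hb0 : 0 ≤ b) (hb1 : b ≤ 1)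
    {l : stdSimplex ℝ M} {p : M → stdSimplex ℝ Ω} (hp : p ∈ bayesPlausible μ l)
    (x : Ω × M) (X : Ω → M → ℝ) :
    ∑ ω, Q x.1 ω * ∑ m, normalize (fun m => (1 - b) * ({x} : Set (Ω × M)).indicator 1 (ω, m)
      + b * (l m * p m ω)) l m * X ω m
    = (1 - b) * X x.1 x.2 + b * ∑ m, l m * ∑ ω, p m ω * X ω m := by
  classical
  obtain ⟨ω₀, m₀⟩ := x
  have hind : ∀ ω m, ({(ω₀, m₀)} : Set (Ω × M)).indicator (1 : Ω × M → ℝ) (ω, m)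
      = if ω₀ = ω then (if m₀ = m then 1 else 0) else 0 := fun ω m => by
    rw [Set.indicator_apply]
    simp only [Set.mem_singleton_iff, Prod.mk.injEq, Pi.one_apply, eq_comm (a := ω₀),
      eq_comm (a := m₀), ite_and]
  have hw : ∀ ω m, 0 ≤ (1 - b) * ({(ω₀, m₀)} : Set (Ω × M)).indicator (1 : Ω × M → ℝ) (ω, m)
      + b * (l m * p m ω) := fun ω m => by
    have h1 : 0 ≤ l m * p m ω := mul_nonneg (stdSimplex.zero_le l m) (stdSimplex.zero_le (p m) ω)
    refine add_nonneg (mul_nonneg (by linarith) ?_) (mul_nonneg hb0 h1)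
    exact Set.indicator_nonneg (fun _ _ => zero_le_one) _
  have hQw : ∀ ω, Q ω₀ ω = ∑ m, ((1 - b) * ({(ω₀, m₀)} : Set (Ω × M)).indicator 1 (ω, m)
      + b * (l m * p m ω)) := fun ω => by
    have h1 := hren (fun ω' => if ω' = ω then 1 else 0) ω₀
    simp only [mul_ite, mul_one, mul_zero, Finset.sum_ite_eq', mem_univ, if_true] at h1
    rw [h1, Finset.sum_add_distrib, ← Finset.mul_sum, ← Finset.mul_sum, hp ω]
    simp only [hind]
    split_ifs <;> simp
  simp only [Finset.mul_sum, ← mul_assoc]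
  have hterm : ∀ ω m, Q ω₀ ω * normalize (fun m => (1 - b) *
      ({(ω₀, m₀)} : Set (Ω × M)).indicator 1 (ω, m) + b * (l m * p m ω)) l m
      = (1 - b) * ({(ω₀, m₀)} : Set (Ω × M)).indicator 1 (ω, m) + b * (l m * p m ω) :=
    fun ω m => by
      rw [hQw ω]
      exact Persuasion.sum_mul_normalize (hw ω) l m
  simp only [mul_assoc] at hterm ⊢
  simp only [← mul_assoc (Q _ _), hterm, add_mul, Finset.sum_add_distrib]
  congr 1
  · simp only [hind]
    simp
  · rw [Finset.sum_comm]
    simp only [mul_assoc]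

variable {l : ι → stdSimplex ℝ M} {p : ι → M → stdSimplex ℝ Ω} {i : ℕ → ι} {R : ℕ → Prop}
  [DecidablePred R] {τ : ReceiverStrategy M A}

theorem playExp_reset {n : ℕ} (hn : n = 0 ∨ R n) (f : (Fin (n + 1) → Ω × M × A) → ℝ) :
    playExp Q μ (renewalSender b l p i R) τ (n + 1) f =
      playExp Q μ (renewalSender b l p i R) τ n fun h =>
        ∑ ω, nextStateProb Q μ n h ω * ∑ m, l (i n) m *
          ∑ a, τ n (fun k => (h k).2) m a * f (Fin.snoc (α := fun _ => Ω × M × A) h (ω, m, a)) := by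
  rw [playExp_succ]
  cases n with
  | zero => rfl
  | succ n =>
    have hR : R (n + 1) := by simpa using hn
    simp only [renewalSender, if_pos hR]

theorem playExp_no_reset (hren : IsRenewal Q μ b) (hb0 : 0 ≤ b) (hb1 : b ≤ 1)
    (hp : ∀ i, p i ∈ bayesPlausible μ (l i)) {n : ℕ} (hn : ¬R (n + 1))
    (f : (Fin (n + 2) → Ω × M × A) → ℝ) :
    playExp Q μ (renewalSender b l p i R) τ (n + 2) f =
      (1 - b) * playExp Q μ (renewalSender b l p i R) τ (n + 1) (fun h =>
        ∑ a, τ (n + 1) (fun k => (h k).2) (h (Fin.last n)).2.1 a *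
          f (Fin.snoc (α := fun _ => Ω × M × A) h ((h (Fin.last n)).1, (h (Fin.last n)).2.1, a)))
      + b * playExp Q μ (renewalSender b l p i R) τ (n + 1) (fun h =>
        ∑ m, l (i (n + 1)) m * ∑ ω, p (i (n + 1)) m ω * ∑ a, τ (n + 1) (fun k => (h k).2) m a *
          f (Fin.snoc (α := fun _ => Ω × M × A) h (ω, m, a))) := by
  rw [playExp_succ, ← playExp_const_mul, ← playExp_const_mul, ← playExp_add]
  congr 1
  funext h
  simp only [renewalSender, if_neg hn, nextStateProb]
  exact hren.sum_mul_normalize hb0 hb1 (hp (i (n + 1)))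
    ((h (Fin.last n)).1, (h (Fin.last n)).2.1) fun ω m =>
      ∑ a, τ (n + 1) (fun k => (h k).2) m a * f (Fin.snoc (α := fun _ => Ω × M × A) h (ω, m, a))

theorem sum_mul_sum_centered {X Y : Type*} [Fintype X] [Fintype Y] (q : stdSimplex ℝ X)
    (t : stdSimplex ℝ Y) (G : Y → X → ℝ) :
    ∑ x, q x * ∑ y, t y * (G y x - ∑ x', q x' * G y x') = 0 := by
  have h : ∀ y, ∑ x, q x * (G y x - ∑ x', q x' * G y x') = 0 := fun y => by
    simp only [mul_sub, Finset.sum_sub_distrib, sum_simplex_mul_const, sub_self]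
  calc _ = ∑ y, t y * ∑ x, q x * (G y x - ∑ x', q x' * G y x') := by
        simp only [Finset.mul_sum]
        rw [Finset.sum_comm]
        exact Finset.sum_congr rfl fun y _ => Finset.sum_congr rfl fun x _ => by ring
    _ = 0 := by simp only [h, mul_zero, Finset.sum_const_zero]

theorem snoc_snd {X Y : Type*} {n : ℕ} (h : Fin n → X × Y) (x : X × Y) :
    (fun k => (Fin.snoc (α := fun _ => X × Y) h x k).2)
      = Fin.snoc (α := fun _ => Y) (fun k => (h k).2) x.2 :=
  Fin.comp_snoc Prod.snd h x

/-- Whatever the receiver does, the law of the current state given all that the receiver has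
observed is close to the posterior attached to the current message. The estimate is in terms of
test functions `f` of the receiver's observations and the state. The error only comes from histories
without renewal since the last reset, because keeping the pair (state, message) and drawing it
anew both preserve the intended conditional law. -/
theorem abs_playExp_belief_le [DecidableEq Ω] (hQ : Q ∈ Matrix.rowStochastic ℝ Ω)
    (hren : IsRenewal Q μ b) (hb0 : 0 ≤ b) (hb1 : b ≤ 1) (hp : ∀ i, p i ∈ bayesPlausible μ (l i))
    (hR : ∀ n, ¬R (n + 1) → i (n + 1) = i n) {n : ℕ} {f : (Fin (n + 1) → M × A) → Ω → ℝ} {B : ℝ}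
    (hf : ∀ r ω, |f r ω| ≤ B) :
    |playExp Q μ (renewalSender b l p i R) τ (n + 1) fun h =>
      f (fun k => (h k).2) (h (Fin.last n)).1
        - ∑ ω, p (i n) (h (Fin.last n)).2.1 ω * f (fun k => (h k).2) ω|
      ≤ B * beliefError b R n := by
  have htriv : ∀ (n : ℕ) (f : (Fin (n + 1) → M × A) → Ω → ℝ), (∀ r ω, |f r ω| ≤ B) →
      |playExp Q μ (renewalSender b l p i R) τ (n + 1) fun h =>
      f (fun k => (h k).2) (h (Fin.last n)).1
        - ∑ ω, p (i n) (h (Fin.last n)).2.1 ω * f (fun k => (h k).2) ω| ≤ B * 2 := by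
    intro n f hf
    refine abs_playExp_le hQ fun h => (abs_sub _ _).trans ?_
    have h1 := hf (fun k => (h k).2) (h (Fin.last n)).1
    have h2 := abs_sum_simplex_mul_le (p (i n) (h (Fin.last n)).2.1) (hf fun k => (h k).2)
    linarith
  induction n with
  | zero => exact htriv 0 f hf
  | succ n ih =>
    rw [beliefError]
    split_ifs with hn
    · exact htriv (n + 1) f hf
    · rw [playExp_no_reset hren hb0 hb1 hp hn]
      simp only [Fin.snoc_last, snoc_snd]
      have hzero : ∀ h : Fin (n + 1) → Ω × M × A,
          ∑ m, l (i (n + 1)) m * ∑ ω, p (i (n + 1)) m ω *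
            ∑ a, τ (n + 1) (fun k => (h k).2) m a *
              (f (Fin.snoc (α := fun _ => M × A) (fun k => (h k).2) (m, a)) ω
              - ∑ ω', p (i (n + 1)) m ω' *
                f (Fin.snoc (α := fun _ => M × A) (fun k => (h k).2) (m, a)) ω') = 0 := by
        intro h
        exact Finset.sum_eq_zero fun m _ => by rw [sum_mul_sum_centered, mul_zero]
      simp only [hzero]
      rw [playExp_const hQ, mul_zero, add_zero, abs_mul, abs_of_nonneg (by linarith : 0 ≤ 1 - b)]
      have := ih (f := fun r ω => ∑ a, τ (n + 1) r (r (Fin.last n)).1 a *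
        f (Fin.snoc (α := fun _ => M × A) r ((r (Fin.last n)).1, a)) ω)
        fun r ω => abs_sum_simplex_mul_le _ fun a => hf _ ω
      refine (mul_le_mul_of_nonneg_left (le_trans (le_of_eq ?_) this)
        (by linarith : 0 ≤ 1 - b)).trans (le_of_eq (by ring))
      congr 2
      funext h
      rw [hR n hn]
      simp only [mul_sub, Finset.sum_sub_distrib]
      congr 1
      simp only [Finset.mul_sum]
      rw [Finset.sum_comm]
      exact Finset.sum_congr rfl fun ω _ => Finset.sum_congr rfl fun a _ => by ring

/-- On the equilibrium path the messages form a Markov chain of their own, with independent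
restarts: a function of the past messages and the current one integrates as follows. -/
theorem playExp_message_reset [DecidableEq Ω] (hQ : Q ∈ Matrix.rowStochastic ℝ Ω) {n : ℕ}
    (hn : n = 0 ∨ R n) (F : (Fin n → M) → M → ℝ) :
    playExp Q μ (renewalSender b l p i R) τ (n + 1)
        (fun h => F (fun k => (h k.castSucc).2.1) (h (Fin.last n)).2.1) =
      playExp Q μ (renewalSender b l p i R) τ n
        (fun h => ∑ m, l (i n) m * F (fun k => (h k).2.1) m) := by
  rw [playExp_reset hn]
  simp only [Fin.snoc_last, Fin.snoc_castSucc, sum_simplex_mul_const]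
  simp only [← Finset.sum_mul, sum_nextStateProb hQ, one_mul]

theorem playExp_message_no_reset (hren : IsRenewal Q μ b) (hb0 : 0 ≤ b)
    (hb1 : b ≤ 1) (hp : ∀ i, p i ∈ bayesPlausible μ (l i)) {n : ℕ} (hn : ¬R (n + 1))
    (F : (Fin (n + 1) → M) → M → ℝ) :
    playExp Q μ (renewalSender b l p i R) τ (n + 2)
        (fun h => F (fun k => (h k.castSucc).2.1) (h (Fin.last (n + 1))).2.1) =
      (1 - b) * playExp Q μ (renewalSender b l p i R) τ (n + 1)
        (fun h => F (fun k => (h k).2.1) (h (Fin.last n)).2.1)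
      + b * playExp Q μ (renewalSender b l p i R) τ (n + 1)
        (fun h => ∑ m, l (i (n + 1)) m * F (fun k => (h k).2.1) m) := by
  rw [playExp_no_reset hren hb0 hb1 hp hn]
  simp only [Fin.snoc_last, Fin.snoc_castSucc, sum_simplex_mul_const]

/-- In every period the message follows the marginal of the scheduled equilibrium. -/
theorem playExp_message [DecidableEq Ω] (hQ : Q ∈ Matrix.rowStochastic ℝ Ω)
    (hren : IsRenewal Q μ b) (hb0 : 0 ≤ b) (hb1 : b ≤ 1) (hp : ∀ i, p i ∈ bayesPlausible μ (l i))
    (hR : ∀ n, ¬R (n + 1) → i (n + 1) = i n) (n : ℕ) (g : M → ℝ) :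
    playExp Q μ (renewalSender b l p i R) τ (n + 1) (fun h => g (h (Fin.last n)).2.1)
      = ∑ m, l (i n) m * g m := by
  induction n with
  | zero =>
    rw [playExp_message_reset hQ (Or.inl rfl) fun _ m => g m, playExp_const hQ]
  | succ n ih =>
    by_cases hn : R (n + 1)
    · rw [playExp_message_reset hQ (Or.inr hn) fun _ m => g m, playExp_const hQ]
    · rw [playExp_message_no_reset hren hb0 hb1 hp hn fun _ m => g m, playExp_const hQ, ih, hR n hn]
      ring

end Renewal

/-! ### The receiver's test -/

section Test

variable {M A ι : Type*} [Fintype M] [Fintype A]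

open scoped Classical in
/-- The surplus of message `m` in period `n`, relative to its prescribed frequency, when `x` is
sent; periods in which the equilibrium `k` is not scheduled do not count. -/
noncomputable def surplus (l : ι → stdSimplex ℝ M) (i : ℕ → ι) (k : ι) (m : M) (n : ℕ)
    (x : M) : ℝ :=
  if i n = k then (if x = m then 1 else 0) - l k m else 0

/-- The cumulated surplus of message `m` in the periods in which equilibrium `k` is scheduled. -/
noncomputable def discrepancy (l : ι → stdSimplex ℝ M) (i : ℕ → ι) (k : ι) (m : M) :
    (n : ℕ) → (Fin n → M) → ℝ
  | 0, _ => 0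
  | n + 1, h => discrepancy l i k m n (Fin.init h) + surplus l i k m n (h (Fin.last n))

/-- The receiver's test: it takes place at the squares from `K ^ 2` on, and fails if some
discrepancy exceeds the fraction `η` of the elapsed time. Tests are sparse, so that the
probabilities of false alarms are summable, yet frequent enough to control all times. -/
def Alarm (l : ι → stdSimplex ℝ M) (i : ℕ → ι) (η : ℝ) (K n : ℕ) (h : Fin n → M) : Prop :=
  (IsSquare n ∧ K ^ 2 ≤ n) ∧ ∃ k m, η * n < |discrepancy l i k m n h|

/-- Some test has been failed so far. -/
def Triggered (l : ι → stdSimplex ℝ M) (i : ℕ → ι) (η : ℝ) (K : ℕ) : (n : ℕ) → (Fin n → M) → Prop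
  | 0, _ => False
  | n + 1, h => Triggered l i η K n (Fin.init h) ∨ Alarm l i η K (n + 1) h

open scoped Classical in
/-- The distribution of the message to which the receiver responds when `x` is sent: the message
itself as long as no test has been failed, and a fictitious draw from the prescribed marginal
afterwards. -/
noncomputable def effectiveMessage (l : ι → stdSimplex ℝ M) (i : ℕ → ι) (η : ℝ) (K n : ℕ)
    (h : Fin n → M) (x m : M) : ℝ :=
  if Triggered l i η K n h then l (i n) m else if x = m then 1 else 0

open scoped Classical in
/-- The strategy of the receiver: the scheduled response rule, applied to the message or, once a
test has been failed, to a fictitious message drawn from the prescribed marginal. -/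
noncomputable def testReceiver (l : ι → stdSimplex ℝ M) (κ : ι → M → stdSimplex ℝ A) (i : ℕ → ι)
    (η : ℝ) (K : ℕ) : ReceiverStrategy M A :=
  fun n h x => if Triggered l i η K n (fun k => (h k).1) then mix (l (i n)) (κ (i n)) else κ (i n) x

open scoped Classical in
/-- The discrepancy computed from the effective messages. -/
noncomputable def effectiveDiscrepancy (l : ι → stdSimplex ℝ M) (i : ℕ → ι) (η : ℝ) (K : ℕ) (k : ι)
    (m : M) : (n : ℕ) → (Fin n → M) → ℝ
  | 0, _ => 0
  | n + 1, h => effectiveDiscrepancy l i η K k m n (Fin.init h) +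
      if i n = k then effectiveMessage l i η K n (Fin.init h) (h (Fin.last n)) m - l k m else 0

variable {l : ι → stdSimplex ℝ M} {κ : ι → M → stdSimplex ℝ A} {i : ℕ → ι} {η : ℝ} {K : ℕ}

theorem testReceiver_apply (n : ℕ) (h : Fin n → M × A) (x : M) (a : A) :
    testReceiver l κ i η K n h x a
      = ∑ m, effectiveMessage l i η K n (fun k => (h k).1) x m * κ (i n) m a := by
  classical
  unfold testReceiver effectiveMessage
  split_ifs
  · exact mix_apply _ _ _
  · simp

theorem effectiveMessage_nonneg (n : ℕ) (h : Fin n → M) (x m : M) :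
    0 ≤ effectiveMessage l i η K n h x m := by
  unfold effectiveMessage
  split_ifs
  · exact stdSimplex.zero_le _ _
  · exact zero_le_one
  · exact le_rfl

theorem sum_effectiveMessage (n : ℕ) (h : Fin n → M) (x : M) :
    ∑ m, effectiveMessage l i η K n h x m = 1 := by
  classical
  unfold effectiveMessage
  split_ifs
  · exact stdSimplex.sum_eq_one _
  · simp

theorem abs_surplus_le (k : ι) (m : M) (n : ℕ) (x : M) : |surplus l i k m n x| ≤ 1 := by
  have h0 := stdSimplex.zero_le (l k) m
  have h1 := stdSimplex.le_one (l k) m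
  unfold surplus
  rw [abs_le]
  split_ifs <;> constructor <;> linarith

theorem sum_mul_surplus (k : ι) (m : M) (n : ℕ) : ∑ x, l (i n) x * surplus l i k m n x = 0 := by
  classical
  unfold surplus
  split_ifs with h
  · simp only [h, mul_sub, Finset.sum_sub_distrib, sum_simplex_mul_const]
    simp
  · simp

theorem surplus_congr {n n' : ℕ} (h : i n = i n') (k : ι) (m x : M) :
    surplus l i k m n x = surplus l i k m n' x := by
  unfold surplus
  rw [h]

theorem abs_discrepancy_le (k : ι) (m : M) : ∀ (n : ℕ) (h : Fin n → M),
    |discrepancy l i k m n h| ≤ n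
  | 0, _ => by simp [discrepancy]
  | n + 1, h => by
    rw [discrepancy, Nat.cast_add, Nat.cast_one]
    exact (abs_add_le _ _).trans
      (add_le_add (abs_discrepancy_le k m n _) (abs_surplus_le k m n _))

theorem sqrt_succ_of_not_isSquare {n : ℕ} (h : ¬IsSquare (n + 1)) :
    Nat.sqrt (n + 1) = Nat.sqrt n := by
  obtain ⟨h1, h2⟩ := Nat.eq_sqrt.1 (Eq.refl (Nat.sqrt (n + 1)))
  have h3 : Nat.sqrt (n + 1) * Nat.sqrt (n + 1) ≠ n + 1 := fun h3 => h ⟨_, h3.symm⟩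
  exact Nat.eq_sqrt.2 ⟨by omega, by omega⟩

/-- As long as no test has been failed, the discrepancies are small: they were at the last test,
and few periods have passed since then. -/
theorem abs_discrepancy_le_of_not_triggered (hη : 0 < η) (k : ι) (m : M) (n : ℕ)
    (h : Fin n → M) (hn : ¬Triggered l i η K n h) :
    |discrepancy l i k m n h| ≤ 2 * η * n + (η⁻¹ + K ^ 2) := by
  have key : ∀ (n : ℕ) (h : Fin n → M), ¬Triggered l i η K n h →
      |discrepancy l i k m n h| ≤ η * n + (n - (Nat.sqrt n : ℝ) ^ 2) + K ^ 2 := by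
    intro n
    induction n with
    | zero =>
      intro h _
      simp [discrepancy]
    | succ n ih =>
      intro h hn
      rw [Triggered, not_or] at hn
      have hsq : ((Nat.sqrt (n + 1) : ℕ) : ℝ) ^ 2 ≤ (n + 1 : ℕ) := by
        exact_mod_cast Nat.sqrt_le' (n + 1)
      have hηn : 0 ≤ η * (n + 1 : ℕ) := by positivity
      have hK2 : (0 : ℝ) ≤ K ^ 2 := by positivity
      by_cases hs : IsSquare (n + 1)
      · rcases Nat.lt_or_ge (n + 1) (K ^ 2) with hK | hK
        · have h1 := abs_discrepancy_le (l := l) (i := i) k m (n + 1) h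
          have h2 : ((n + 1 : ℕ) : ℝ) ≤ (K : ℝ) ^ 2 := by exact_mod_cast hK.le
          linarith
        · have h1 : |discrepancy l i k m (n + 1) h| ≤ η * (n + 1 : ℕ) := by
            by_contra hcon
            exact hn.2 ⟨⟨hs, hK⟩, k, m, not_le.1 hcon⟩
          linarith
      · have h1 := ih (Fin.init h) hn.1
        have h2 := abs_surplus_le (l := l) (i := i) k m n (h (Fin.last n))
        have h3 := abs_add_le (discrepancy l i k m n (Fin.init h))
          (surplus l i k m n (h (Fin.last n)))
        rw [sqrt_succ_of_not_isSquare hs, discrepancy]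
        push_cast
        linarith
  have h1 := key n h hn
  have h2 : (n : ℝ) ≤ (Nat.sqrt n : ℝ) ^ 2 + 2 * Nat.sqrt n := by
    have := Nat.sqrt_le_add n
    have h3 : (n : ℝ) ≤ (Nat.sqrt n * Nat.sqrt n + Nat.sqrt n + Nat.sqrt n : ℕ) := by
      exact_mod_cast this
    push_cast at h3
    linarith
  have h3 : (Nat.sqrt n : ℝ) ^ 2 ≤ n := by exact_mod_cast Nat.sqrt_le' n
  have h4 : 2 * (Nat.sqrt n : ℝ) ≤ η * (Nat.sqrt n : ℝ) ^ 2 + η⁻¹ := by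
    have h5 : 0 ≤ η * (Nat.sqrt n - η⁻¹) ^ 2 := by positivity
    have h6 : η * (Nat.sqrt n - η⁻¹) ^ 2
        = η * (Nat.sqrt n : ℝ) ^ 2 + η⁻¹ - 2 * Nat.sqrt n := by field_simp; ring
    linarith
  have h5 := mul_le_mul_of_nonneg_left h3 hη.le
  linarith

theorem effectiveDiscrepancy_succ_of_not_triggered (k : ι) (m : M) (n : ℕ) (h : Fin (n + 1) → M)
    (hn : ¬Triggered l i η K n (Fin.init h)) :
    effectiveDiscrepancy l i η K k m (n + 1) h =
      effectiveDiscrepancy l i η K k m n (Fin.init h) + surplus l i k m n (h (Fin.last n)) := by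
  rw [effectiveDiscrepancy, effectiveMessage, if_neg hn, surplus]

theorem effectiveDiscrepancy_eq (k : ι) (m : M) : ∀ (n : ℕ) (h : Fin n → M),
    ¬Triggered l i η K n h → effectiveDiscrepancy l i η K k m n h = discrepancy l i k m n h
  | 0, _, _ => rfl
  | n + 1, h, hn => by
    rw [Triggered, not_or] at hn
    rw [effectiveDiscrepancy_succ_of_not_triggered k m n h hn.1,
      effectiveDiscrepancy_eq k m n _ hn.1, discrepancy]

/-- The frequencies of the effective messages are nearly right whatever messages are sent. -/
theorem abs_effectiveDiscrepancy_le (hη : 0 < η) (k : ι) (m : M) : ∀ (n : ℕ) (h : Fin n → M),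
    |effectiveDiscrepancy l i η K k m n h| ≤ 2 * η * n + (η⁻¹ + K ^ 2 + 1)
  | 0, _ => by
    rw [effectiveDiscrepancy, abs_zero]
    positivity
  | n + 1, h => by
    have hmono : 2 * η * (n : ℝ) ≤ 2 * η * (n + 1 : ℕ) := by
      push_cast
      linarith
    by_cases hn : Triggered l i η K n (Fin.init h)
    · have h1 := abs_effectiveDiscrepancy_le hη k m n (Fin.init h)
      rw [effectiveDiscrepancy, effectiveMessage, if_pos hn]
      split_ifs with h2
      · rw [h2, sub_self, add_zero]
        linarith
      · rw [add_zero]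
        linarith
    · rw [effectiveDiscrepancy_succ_of_not_triggered k m n h hn, effectiveDiscrepancy_eq k m n _ hn]
      have h1 := abs_discrepancy_le_of_not_triggered hη k m n (Fin.init h) hn
      have h2 := abs_surplus_le (l := l) (i := i) k m n (h (Fin.last n))
      have h3 := abs_add_le (discrepancy l i k m n (Fin.init h))
        (surplus l i k m n (h (Fin.last n)))
      linarith

end Test

/-! ### False alarms on the equilibrium path -/

section FalseAlarms

variable {Ω M A ι : Type*} [Fintype Ω] [DecidableEq Ω] [Fintype M] [Fintype A]
variable {Q : Matrix Ω Ω ℝ} {μ : stdSimplex ℝ Ω} {b : ℝ}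
  {l : ι → stdSimplex ℝ M} {p : ι → M → stdSimplex ℝ Ω} {i : ℕ → ι} {R : ℕ → Prop}
  [DecidablePred R] {τ : ReceiverStrategy M A} {η : ℝ} {K : ℕ}

theorem abs_playExp_discrepancy_mul_surplus_le (hQ : Q ∈ Matrix.rowStochastic ℝ Ω)
    (hren : IsRenewal Q μ b) (hb0 : 0 < b) (hb1 : b ≤ 1) (hp : ∀ i, p i ∈ bayesPlausible μ (l i))
    (hR : ∀ n, ¬R (n + 1) → i (n + 1) = i n) (k : ι) (m : M) (n : ℕ) :
    |playExp Q μ (renewalSender b l p i R) τ (n + 1) fun h =>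
      discrepancy l i k m n (fun k => (h k.castSucc).2.1)
        * surplus l i k m n (h (Fin.last n)).2.1| ≤ b⁻¹ := by
  have hreset : ∀ n, (n = 0 ∨ R n) →
      |playExp Q μ (renewalSender b l p i R) τ (n + 1) fun h =>
        discrepancy l i k m n (fun k => (h k.castSucc).2.1)
          * surplus l i k m n (h (Fin.last n)).2.1| ≤ b⁻¹ := by
    intro n hn
    rw [playExp_message_reset hQ hn fun g x => discrepancy l i k m n g * surplus l i k m n x]
    simp only [mul_left_comm (l _ _), ← Finset.mul_sum, sum_mul_surplus, mul_zero]
    rw [playExp_const hQ, abs_zero]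
    positivity
  induction n with
  | zero => exact hreset 0 (Or.inl rfl)
  | succ n ih =>
    by_cases hn : R (n + 1)
    · exact hreset (n + 1) (Or.inr hn)
    · rw [playExp_message_no_reset hren hb0.le hb1 hp hn fun g x =>
        discrepancy l i k m (n + 1) g * surplus l i k m (n + 1) x]
      simp only [mul_left_comm (l _ _), ← Finset.mul_sum, sum_mul_surplus, mul_zero]
      rw [playExp_const hQ, mul_zero, add_zero]
      simp only [surplus_congr (hR n hn), discrepancy, add_mul]
      rw [playExp_add, abs_mul, abs_of_nonneg (by linarith : 0 ≤ 1 - b)]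
      have h1 : |playExp Q μ (renewalSender b l p i R) τ (n + 1) fun h =>
          surplus l i k m n (h (Fin.last n)).2.1 * surplus l i k m n (h (Fin.last n)).2.1| ≤ 1 :=
        abs_playExp_le hQ fun h => by
          rw [abs_mul]
          exact mul_le_one₀ (abs_surplus_le _ _ _ _) (abs_nonneg _) (abs_surplus_le _ _ _ _)
      have h2 := (abs_add_le _ _).trans (add_le_add ih h1)
      calc _ ≤ (1 - b) * (b⁻¹ + 1) := mul_le_mul_of_nonneg_left h2 (by linarith)
        _ = b⁻¹ - b := by field_simp; ring
        _ ≤ b⁻¹ := by linarith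

/-- On the equilibrium path the correlations of the messages decay geometrically, so that the
second moment of the discrepancies grows linearly. -/
theorem playExp_discrepancy_sq_le (hQ : Q ∈ Matrix.rowStochastic ℝ Ω)
    (hren : IsRenewal Q μ b) (hb0 : 0 < b) (hb1 : b ≤ 1) (hp : ∀ i, p i ∈ bayesPlausible μ (l i))
    (hR : ∀ n, ¬R (n + 1) → i (n + 1) = i n) (k : ι) (m : M) (n : ℕ) :
    playExp Q μ (renewalSender b l p i R) τ n
      (fun h => discrepancy l i k m n (fun k => (h k).2.1) ^ 2) ≤ n * (1 + 2 * b⁻¹) := by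
  induction n with
  | zero => simp [playExp_zero, discrepancy]
  | succ n ih =>
    have hsplit : ∀ h : Fin (n + 1) → Ω × M × A,
        discrepancy l i k m (n + 1) (fun k => (h k).2.1) ^ 2
        = discrepancy l i k m n (fun k => (Fin.init h k).2.1) ^ 2
          + (2 * (discrepancy l i k m n (fun k => (h k.castSucc).2.1)
            * surplus l i k m n (h (Fin.last n)).2.1)
          + surplus l i k m n (h (Fin.last n)).2.1 ^ 2) := fun h => by
      rw [discrepancy]
      show (discrepancy l i k m n (fun k => (h k.castSucc).2.1) + _) ^ 2
        = discrepancy l i k m n (fun k => (h k.castSucc).2.1) ^ 2 + _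
      ring
    simp only [hsplit]
    rw [playExp_add, playExp_add, playExp_const_mul, playExp_init hQ n fun h =>
      discrepancy l i k m n (fun k => (h k).2.1) ^ 2]
    have h1 := abs_playExp_discrepancy_mul_surplus_le (τ := τ) hQ hren hb0 hb1 hp hR k m n
    have h2 : |playExp Q μ (renewalSender b l p i R) τ (n + 1) fun h =>
        surplus l i k m n (h (Fin.last n)).2.1 ^ 2| ≤ 1 :=
      abs_playExp_le hQ fun h => by
        rw [abs_pow]
        exact pow_le_one₀ (abs_nonneg _) (abs_surplus_le _ _ _ _)
    have h3 := (abs_le.1 h1).2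
    have h4 := (abs_le.1 h2).2
    push_cast
    linarith

/-- Chebyshev's inequality for one test. -/
theorem playExp_alarm_le [Fintype ι] (hQ : Q ∈ Matrix.rowStochastic ℝ Ω)
    (hren : IsRenewal Q μ b) (hb0 : 0 < b) (hb1 : b ≤ 1) (hp : ∀ i, p i ∈ bayesPlausible μ (l i))
    (hR : ∀ n, ¬R (n + 1) → i (n + 1) = i n) (hη : 0 < η) (hK : 0 < K) (n : ℕ) :
    playExp Q μ (renewalSender b l p i R) τ n
        (fun h => {g | Alarm l i η K n g}.indicator (1 : (Fin n → M) → ℝ) fun k => (h k).2.1) ≤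
      Fintype.card ι * Fintype.card M * (1 + 2 * b⁻¹) / η ^ 2 *
        if IsSquare n ∧ K ^ 2 ≤ n then (n : ℝ)⁻¹ else 0 := by
  classical
  split_ifs with hn
  · have hn0 : (0 : ℝ) < n := by
      have : 0 < K ^ 2 := by positivity
      exact_mod_cast this.trans_le hn.2
    have hpt : ∀ g : Fin n → M, {g | Alarm l i η K n g}.indicator (1 : (Fin n → M) → ℝ) g
        ≤ ((η * n) ^ 2)⁻¹ * ∑ k, ∑ m, discrepancy l i k m n g ^ 2 := by
      intro g
      by_cases hg : g ∈ {g | Alarm l i η K n g}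
      · rw [Set.indicator_of_mem hg, Pi.one_apply]
        obtain ⟨-, k, m, hkm⟩ := hg
        rw [← div_eq_inv_mul, one_le_div (by positivity)]
        calc (η * n) ^ 2 ≤ discrepancy l i k m n g ^ 2 := by
              rw [← sq_abs (discrepancy l i k m n g)]
              exact pow_le_pow_left₀ (by positivity) hkm.le 2
          _ ≤ ∑ m, discrepancy l i k m n g ^ 2 := single_le_sum
            (f := fun m => discrepancy l i k m n g ^ 2) (fun _ _ => sq_nonneg _) (mem_univ m)
          _ ≤ _ := single_le_sum (f := fun k => ∑ m, discrepancy l i k m n g ^ 2)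
            (fun _ _ => Finset.sum_nonneg fun _ _ => sq_nonneg _) (mem_univ k)
      · rw [Set.indicator_of_notMem hg]
        exact mul_nonneg (by positivity)
          (Finset.sum_nonneg fun _ _ => Finset.sum_nonneg fun _ _ => sq_nonneg _)
    calc _ ≤ playExp Q μ (renewalSender b l p i R) τ n (fun h => ((η * n) ^ 2)⁻¹ *
          ∑ k, ∑ m, discrepancy l i k m n (fun k => (h k).2.1) ^ 2) :=
        playExp_mono hQ fun h => hpt _
      _ ≤ ((η * n) ^ 2)⁻¹ * ∑ _k : ι, ∑ _m : M, n * (1 + 2 * b⁻¹) := by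
        rw [playExp_const_mul, playExp_sum]
        simp only [playExp_sum]
        exact mul_le_mul_of_nonneg_left (Finset.sum_le_sum fun k _ => Finset.sum_le_sum fun m _ =>
          playExp_discrepancy_sq_le hQ hren hb0 hb1 hp hR k m n) (by positivity)
      _ = _ := by
        simp only [Finset.sum_const, card_univ, nsmul_eq_mul]
        field_simp
  · have : {g | Alarm l i η K n g} = ∅ :=
      Set.eq_empty_of_forall_notMem fun g hg => hn hg.1
    simp only [this, Set.indicator_empty]
    rw [playExp_const hQ, mul_zero]

/-- On the equilibrium path a test is ever failed only with a small probability. -/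
theorem playExp_triggered_le [Fintype ι] (hQ : Q ∈ Matrix.rowStochastic ℝ Ω)
    (hren : IsRenewal Q μ b) (hb0 : 0 < b) (hb1 : b ≤ 1) (hp : ∀ i, p i ∈ bayesPlausible μ (l i))
    (hR : ∀ n, ¬R (n + 1) → i (n + 1) = i n) (hη : 0 < η) (hK : 0 < K) (n : ℕ) :
    playExp Q μ (renewalSender b l p i R) τ n
        (fun h => {g | Triggered l i η K n g}.indicator (1 : (Fin n → M) → ℝ) fun k => (h k).2.1) ≤
      Fintype.card ι * Fintype.card M * (1 + 2 * b⁻¹) / η ^ 2 * (2 / K) := by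
  classical
  have key : ∀ n, playExp Q μ (renewalSender b l p i R) τ n
        (fun h => {g | Triggered l i η K n g}.indicator (1 : (Fin n → M) → ℝ) fun k => (h k).2.1) ≤
      Fintype.card ι * Fintype.card M * (1 + 2 * b⁻¹) / η ^ 2 *
        ∑ j ∈ range (n + 1), if IsSquare j ∧ K ^ 2 ≤ j then (j : ℝ)⁻¹ else 0 := by
    intro n
    induction n with
    | zero =>
      rw [playExp_zero, Set.indicator_of_notMem (by simp [Triggered])]
      refine mul_nonneg (by positivity) (Finset.sum_nonneg fun j _ => ?_)
      split_ifs <;> positivity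
    | succ n ih =>
      rw [Finset.sum_range_succ, mul_add]
      refine le_trans ?_ (add_le_add ih (playExp_alarm_le (τ := τ) hQ hren hb0 hb1 hp hR hη hK
        (n + 1)))
      rw [← playExp_init hQ n, ← playExp_add]
      refine playExp_mono hQ fun h => ?_
      simp only [Set.indicator_apply, Set.mem_ofPred_eq, Triggered, Pi.one_apply]
      have : Fin.init (fun k => (h k).2.1) = fun k => (Fin.init h k).2.1 := rfl
      rw [this]
      by_cases h1 : Triggered l i η K n fun k => (Fin.init h k).2.1 <;>
      by_cases h2 : Alarm l i η K (n + 1) fun k => (h k).2.1 <;> simp [h1, h2]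
  exact (key n).trans (mul_le_mul_of_nonneg_left (sum_inv_squares_le hK (n + 1)) (by positivity))

end FalseAlarms

/-! ### Payoffs and deviations -/

section Payoffs

variable {Ω M A ι : Type*} [Fintype Ω] [DecidableEq Ω] [Fintype M] [Fintype A]
variable {Q : Matrix Ω Ω ℝ} {μ : stdSimplex ℝ Ω} {b B : ℝ}
  {l : ι → stdSimplex ℝ M} {p : ι → M → stdSimplex ℝ Ω} {κ : ι → M → stdSimplex ℝ A} {i : ℕ → ι}
  {R : ℕ → Prop} [DecidablePred R] {η : ℝ} {K : ℕ} {u uS uR : Ω → A → ℝ}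

omit [DecidableEq Ω] in
/-- Against the testing receiver, the stage payoff is that of the effective message. -/
theorem expectedStagePayoff_testReceiver (σ : SenderStrategy Ω M) (n : ℕ) :
    expectedStagePayoff Q μ u σ (testReceiver l κ i η K) n =
      playExp Q μ σ (testReceiver l κ i η K) (n + 1) fun h =>
        ∑ m, effectiveMessage l i η K n (fun k => (h k.castSucc).2.1) (h (Fin.last n)).2.1 m *
          ∑ a, κ (i n) m a * u (h (Fin.last n)).1 a := by
  rw [expectedStagePayoff_eq_playExp, playExp_succ, playExp_succ]
  simp only [Fin.snoc_last, Fin.snoc_castSucc, sum_simplex_mul_const]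
  congr 1
  funext h
  refine Finset.sum_congr rfl fun ω _ => ?_
  congr 1
  refine Finset.sum_congr rfl fun m _ => ?_
  congr 1
  simp only [testReceiver_apply, Finset.sum_mul, Finset.mul_sum]
  rw [Finset.sum_comm]
  simp only [mul_assoc]

theorem sum_playExp_effectiveMessage (hQ : Q ∈ Matrix.rowStochastic ℝ Ω)
    (σ : SenderStrategy Ω M) (τ : ReceiverStrategy M A) [DecidableEq ι] (k : ι) (m : M) (N : ℕ) :
    ∑ n ∈ range N, (if i n = k then playExp Q μ σ τ (n + 1) (fun h =>
        effectiveMessage l i η K n (fun k => (h k.castSucc).2.1) (h (Fin.last n)).2.1 m) - l k m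
      else 0)
      = playExp Q μ σ τ N fun h => effectiveDiscrepancy l i η K k m N fun k => (h k).2.1 := by
  induction N with
  | zero => simp [playExp_zero, effectiveDiscrepancy]
  | succ N ih =>
    simp only [effectiveDiscrepancy]
    rw [playExp_add, Finset.sum_range_succ, ih]
    congr 1
    · exact (playExp_init hQ N fun h => effectiveDiscrepancy l i η K k m N fun k => (h k).2.1).symm
    · split_ifs with h
      · rw [playExp_sub, playExp_const hQ]
        rfl
      · exact (playExp_const hQ _ _).symm

/-- No strategy of the sender gains against the testing receiver: for every scheduled equilibrium,
the expected joint frequencies of states and effective messages have the right state marginal, by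
stationarity, and nearly the right message marginal, by the test. -/
theorem sum_expectedStagePayoff_testReceiver_le [Fintype ι] (hQ : Q ∈ Matrix.rowStochastic ℝ Ω)
    (hμ : IsInvariantDist Q μ) (heq : ∀ k, IsStaticEquilibrium uS uR μ (l k) (p k) (κ k))
    (hB : ∀ ω a, |uS ω a| ≤ B) (hη : 0 < η) (σ : SenderStrategy Ω M) (N : ℕ) :
    ∑ n ∈ range N, expectedStagePayoff Q μ uS σ (testReceiver l κ i η K) n ≤
      ∑ n ∈ range N, staticPayoff uS (l (i n)) (p (i n)) (κ (i n))
        + Fintype.card ι * (2 * B * Fintype.card M * (2 * η * N + (η⁻¹ + K ^ 2 + 1))) := by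
  classical
  set τ : ReceiverStrategy M A := testReceiver l κ i η K with hτ
  set J : ℕ → Ω → M → ℝ := fun n ω m => playExp Q μ σ τ (n + 1) fun h =>
    (if (h (Fin.last n)).1 = ω then 1 else 0) *
      effectiveMessage l i η K n (fun k => (h k.castSucc).2.1) (h (Fin.last n)).2.1 m with hJ
  have hJ0 : ∀ n ω m, 0 ≤ J n ω m := fun n ω m => playExp_nonneg hQ fun h =>
    mul_nonneg (by split_ifs <;> norm_num) (effectiveMessage_nonneg _ _ _ _)
  have hstage : ∀ n, expectedStagePayoff Q μ uS σ τ n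
      = ∑ ω, ∑ m, J n ω m * ∑ a, κ (i n) m a * uS ω a := fun n => by
    rw [hτ, expectedStagePayoff_testReceiver, ← hτ]
    simp only [hJ, ← playExp_mul_const, ← playExp_sum]
    congr 1
    funext h
    rw [Finset.sum_comm]
    refine Finset.sum_congr rfl fun m _ => ?_
    simp [ite_mul]
  have hJΩ : ∀ n ω, ∑ m, J n ω m = μ ω := fun n ω => by
    simp only [hJ, ← playExp_sum, ← Finset.mul_sum, sum_effectiveMessage, mul_one]
    rw [playExp_state hμ n fun ω' => if ω' = ω then 1 else 0]
    simp
  have hJM : ∀ n m, ∑ ω, J n ω m = playExp Q μ σ τ (n + 1) (fun h =>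
      effectiveMessage l i η K n (fun k => (h k.castSucc).2.1) (h (Fin.last n)).2.1 m) := by
    intro n m
    simp only [hJ, ← playExp_sum, ← Finset.sum_mul]
    simp
  have hk : ∀ k, ∑ n ∈ range N, (if i n = k then expectedStagePayoff Q μ uS σ τ n else 0) ≤
      ∑ n ∈ range N, (if i n = k then staticPayoff uS (l (i n)) (p (i n)) (κ (i n)) else 0)
        + 2 * B * Fintype.card M * (2 * η * N + (η⁻¹ + K ^ 2 + 1)) := by
    intro k
    set W : ℝ := ∑ n ∈ range N, if i n = k then (1 : ℝ) else 0 with hW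
    have hW0 : 0 ≤ W := Finset.sum_nonneg fun n _ => by split_ifs <;> norm_num
    have hΩ : ∀ ω, ∑ m, ∑ n ∈ range N, (if i n = k then J n ω m else 0) = W * μ ω := fun ω => by
      rw [Finset.sum_comm, hW, Finset.sum_mul]
      refine Finset.sum_congr rfl fun n _ => ?_
      split_ifs
      · rw [hJΩ, one_mul]
      · simp
    have hM : ∀ m, |∑ ω, ∑ n ∈ range N, (if i n = k then J n ω m else 0) - W * l k m|
        ≤ 2 * η * N + (η⁻¹ + K ^ 2 + 1) := fun m => by
      have h1 : ∑ ω, ∑ n ∈ range N, (if i n = k then J n ω m else 0) - W * l k m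
          = playExp Q μ σ τ N fun h => effectiveDiscrepancy l i η K k m N fun k => (h k).2.1 := by
        rw [← sum_playExp_effectiveMessage hQ, Finset.sum_comm, hW, Finset.sum_mul,
          ← Finset.sum_sub_distrib]
        refine Finset.sum_congr rfl fun n _ => ?_
        split_ifs
        · rw [hJM, one_mul]
        · simp
      rw [h1]
      exact abs_playExp_le hQ fun h => abs_effectiveDiscrepancy_le hη k m N _
    have := (heq k).sum_le hB hW0
      (fun ω m => Finset.sum_nonneg fun n _ => by
        split_ifs
        · exact hJ0 n ω m
        · exact le_rfl) hΩ hM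
    refine le_trans (le_of_eq ?_) (this.trans (le_of_eq ?_))
    · simp only [Finset.sum_mul]
      simp only [Finset.sum_comm (s := (univ : Finset M)) (t := range N)]
      rw [Finset.sum_comm]
      refine Finset.sum_congr rfl fun n _ => ?_
      split_ifs with h
      · rw [hstage, h]
      · simp
    · congr 1
      rw [hW, Finset.sum_mul]
      refine Finset.sum_congr rfl fun n _ => ?_
      split_ifs with h
      · rw [h, one_mul]
      · simp
  have hsplit : ∀ x : ℕ → ℝ, ∑ n ∈ range N, x n
      = ∑ k, ∑ n ∈ range N, if i n = k then x n else 0 := fun x => by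
    rw [Finset.sum_comm]
    simp
  rw [hsplit, hsplit fun n => staticPayoff uS (l (i n)) (p (i n)) (κ (i n))]
  refine (Finset.sum_le_sum fun k _ => hk k).trans (le_of_eq ?_)
  rw [Finset.sum_add_distrib, Finset.sum_const, card_univ, nsmul_eq_mul]

/-- On the equilibrium path, the stage payoff differs from that of the scheduled static equilibrium
only through the error in the receiver's belief and the possibility of a false alarm. -/
theorem abs_expectedStagePayoff_sub_staticPayoff_le (hQ : Q ∈ Matrix.rowStochastic ℝ Ω)
    (hren : IsRenewal Q μ b) (hb0 : 0 ≤ b) (hb1 : b ≤ 1) (hp : ∀ i, p i ∈ bayesPlausible μ (l i))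
    (hR : ∀ n, ¬R (n + 1) → i (n + 1) = i n) (hB : ∀ ω a, |u ω a| ≤ B) (n : ℕ) :
    |expectedStagePayoff Q μ u (renewalSender b l p i R) (testReceiver l κ i η K) n
      - staticPayoff u (l (i n)) (p (i n)) (κ (i n))| ≤
      B * beliefError b R n + 2 * B * playExp Q μ (renewalSender b l p i R)
        (testReceiver l κ i η K) n (fun h =>
          {g | Triggered l i η K n g}.indicator (1 : (Fin n → M) → ℝ) fun k => (h k).2.1) := by
  classical
  set τ : ReceiverStrategy M A := testReceiver l κ i η K with hτ
  set σ : SenderStrategy Ω M := renewalSender b l p i R with hσ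
  set v : Ω → M → ℝ := fun ω m => ∑ a, κ (i n) m a * u ω a with hv
  have hvB : ∀ ω m, |v ω m| ≤ B := fun ω m => abs_sum_simplex_mul_le (κ (i n) m) (hB ω)
  set T : (Fin n → M) → ℝ := {g | Triggered l i η K n g}.indicator 1 with hT
  -- the difference splits into a false alarm, an error in belief, and zero
  have h1 : |playExp Q μ σ τ (n + 1) fun h =>
      ∑ m, effectiveMessage l i η K n (fun k => (h k.castSucc).2.1) (h (Fin.last n)).2.1 m *
          v (h (Fin.last n)).1 m - v (h (Fin.last n)).1 (h (Fin.last n)).2.1|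
      ≤ 2 * B * playExp Q μ σ τ n fun h => T fun k => (h k).2.1 := by
    have hpt : ∀ h : Fin (n + 1) → Ω × M × A,
        |∑ m, effectiveMessage l i η K n (fun k => (h k.castSucc).2.1) (h (Fin.last n)).2.1 m *
          v (h (Fin.last n)).1 m - v (h (Fin.last n)).1 (h (Fin.last n)).2.1|
        ≤ 2 * B * T fun k => (Fin.init h k).2.1 := by
      intro h
      have hinit : (fun k => (Fin.init h k).2.1) = fun k => (h k.castSucc).2.1 := rfl
      rw [hinit, hT]
      by_cases ht : Triggered l i η K n fun k => (h k.castSucc).2.1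
      · rw [Set.indicator_of_mem (show _ ∈ {g | Triggered l i η K n g} from ht)]
        simp only [effectiveMessage, if_pos ht]
        have h2 := abs_sum_simplex_mul_le (l (i n)) (hvB (h (Fin.last n)).1)
        have h3 := hvB (h (Fin.last n)).1 (h (Fin.last n)).2.1
        refine (abs_sub _ _).trans ?_
        rw [Pi.one_apply]
        linarith
      · rw [Set.indicator_of_notMem (show _ ∉ {g | Triggered l i η K n g} from ht)]
        simp only [effectiveMessage, if_neg ht]
        simp
    rw [← playExp_init hQ n, ← playExp_const_mul, abs_le, neg_eq_neg_one_mul, ← playExp_const_mul]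
    constructor
    · refine playExp_mono hQ fun h => ?_
      have := (abs_le.1 (hpt h)).1
      linarith
    · exact playExp_mono hQ fun h => (abs_le.1 (hpt h)).2
  have h2 := abs_playExp_belief_le (τ := τ) hQ hren hb0 hb1 hp hR (n := n)
    (f := fun r ω => v ω (r (Fin.last n)).1) fun r ω => hvB ω _
  have h3 : playExp Q μ σ τ (n + 1) (fun h => ∑ ω, p (i n) (h (Fin.last n)).2.1 ω *
      v ω (h (Fin.last n)).2.1) = staticPayoff u (l (i n)) (p (i n)) (κ (i n)) :=
    playExp_message hQ hren hb0 hb1 hp hR n fun m => ∑ ω, p (i n) m ω * v ω m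
  rw [playExp_sub] at h1 h2
  rw [hτ, expectedStagePayoff_testReceiver, ← hτ, ← h3]
  refine (abs_sub_le _ (playExp Q μ σ τ (n + 1) fun h =>
    v (h (Fin.last n)).1 (h (Fin.last n)).2.1) _).trans ?_
  rw [add_comm]
  exact add_le_add h2 h1

/-- Against the sender's strategy the receiver gains at most the error in his belief: he cannot
influence the sender, and a best response to the posterior is played anyway. -/
theorem expectedStagePayoff_renewalSender_le (hQ : Q ∈ Matrix.rowStochastic ℝ Ω)
    (hren : IsRenewal Q μ b) (hb0 : 0 ≤ b) (hb1 : b ≤ 1)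
    (heq : ∀ k, IsStaticEquilibrium uS uR μ (l k) (p k) (κ k))
    (hR : ∀ n, ¬R (n + 1) → i (n + 1) = i n) (hB : ∀ ω a, |uR ω a| ≤ B)
    (τ : ReceiverStrategy M A) (n : ℕ) :
    expectedStagePayoff Q μ uR (renewalSender b l p i R) τ n ≤
      staticPayoff uR (l (i n)) (p (i n)) (κ (i n)) + B * beliefError b R n := by
  classical
  have hp : ∀ k, p k ∈ bayesPlausible μ (l k) := fun k => (heq k).plausible
  set σ : SenderStrategy Ω M := renewalSender b l p i R with hσ
  -- messages that are never sent only get the trivial bound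
  set G : M → ℝ := fun m =>
    if 0 < l (i n) m then ∑ ω, p (i n) m ω * ∑ a, κ (i n) m a * uR ω a else B with hG
  have hbest : ∀ m a, ∑ ω, p (i n) m ω * uR ω a ≤ G m := by
    intro m a
    simp only [hG]
    split_ifs with hm
    · calc ∑ ω, p (i n) m ω * uR ω a
          = ∑ a', κ (i n) m a' * ∑ ω, p (i n) m ω * uR ω a := (sum_simplex_mul_const _ _).symm
        _ ≤ ∑ a', κ (i n) m a' * ∑ ω, p (i n) m ω * uR ω a' := by
          refine Finset.sum_le_sum fun a' _ => ?_
          rcases (stdSimplex.zero_le (κ (i n) m) a').eq_or_lt with h | h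
          · rw [← h, zero_mul, zero_mul]
          · exact mul_le_mul_of_nonneg_left ((heq (i n)).receiver m hm a' h a) h.le
        _ = _ := by
          simp only [Finset.mul_sum]
          rw [Finset.sum_comm]
          exact Finset.sum_congr rfl fun ω _ => Finset.sum_congr rfl fun a _ => by ring
    · exact (le_abs_self _).trans (abs_sum_simplex_mul_le _ fun ω => hB ω a)
  have h1 := abs_playExp_belief_le (τ := τ) hQ hren hb0 hb1 hp hR (n := n)
    (f := fun r ω => uR ω (r (Fin.last n)).2) fun r ω => hB ω _
  have h2 : playExp Q μ σ τ (n + 1) (fun h => ∑ ω, p (i n) (h (Fin.last n)).2.1 ω *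
      uR ω (h (Fin.last n)).2.2) ≤ ∑ m, l (i n) m * G m := by
    rw [← playExp_message (τ := τ) hQ hren hb0 hb1 hp hR n G]
    exact playExp_mono hQ fun h => hbest _ _
  have h3 : ∑ m, l (i n) m * G m = staticPayoff uR (l (i n)) (p (i n)) (κ (i n)) := by
    refine Finset.sum_congr rfl fun m _ => ?_
    rcases (stdSimplex.zero_le (l (i n)) m).eq_or_lt with h | h
    · rw [← h, zero_mul, zero_mul]
    · simp only [hG, if_pos h]
  rw [playExp_sub] at h1
  rw [expectedStagePayoff_eq_playExp]
  linarith [(abs_le.1 h1).2]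

omit [DecidableEq Ω] in
theorem abs_staticPayoff_le (hB : ∀ ω a, |u ω a| ≤ B) (l : stdSimplex ℝ M)
    (p : M → stdSimplex ℝ Ω) (κ : M → stdSimplex ℝ A) : |staticPayoff u l p κ| ≤ B :=
  abs_sum_simplex_mul_le _ fun _ => abs_sum_simplex_mul_le _ fun ω =>
    abs_sum_simplex_mul_le _ (hB ω)

/-- Along a schedule with balanced phases of length `L`, a quantity that depends on the scheduled
index averages to its weighted mean. -/
theorem abs_sum_schedule_sub_le {ι : Type*} [Fintype ι] [DecidableEq ι] {α : ι → ℝ} {c : ℕ → ι}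
    (hα : ∀ i, 0 ≤ α i) (hα1 : ∑ i, α i = 1)
    (hc : ∀ (J : ℕ) (i : ι), |∑ j ∈ range J, ((if c j = i then (1 : ℝ) else 0) - α i)|
      ≤ Fintype.card ι) {L : ℕ} (hL : 0 < L) {V : ι → ℝ} {B : ℝ} (hV : ∀ i, |V i| ≤ B) (N : ℕ) :
    |∑ n ∈ range N, V (c (n / L)) - N * ∑ i, α i * V i|
      ≤ L * (Fintype.card ι * Fintype.card ι * B + 2 * B) := by
  have hmean : |∑ i, α i * V i| ≤ B :=
    abs_sum_simplex_mul_le (⟨α, hα, hα1⟩ : stdSimplex ℝ ι) hV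
  have h1 := abs_sum_range_div_le hL (f := fun j => V (c j) - ∑ i, α i * V i) (B := 2 * B)
    (C := Fintype.card ι * Fintype.card ι * B)
    (fun j => (abs_sub _ _).trans (by linarith [hV (c j)])) (fun J => ?_) N
  · rwa [Finset.sum_sub_distrib, Finset.sum_const, card_range, nsmul_eq_mul] at h1
  · have h2 : ∑ j ∈ range J, (V (c j) - ∑ i, α i * V i)
        = ∑ i, (∑ j ∈ range J, ((if c j = i then (1 : ℝ) else 0) - α i)) * V i := by
      simp only [Finset.sum_mul]
      rw [Finset.sum_comm]
      refine Finset.sum_congr rfl fun j _ => ?_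
      simp [sub_mul, Finset.sum_sub_distrib, ite_mul]
    rw [h2]
    calc _ ≤ ∑ i, |(∑ j ∈ range J, ((if c j = i then (1 : ℝ) else 0) - α i)) * V i| :=
          Finset.abs_sum_le_sum_abs _ _
      _ ≤ ∑ _i : ι, (Fintype.card ι : ℝ) * B := Finset.sum_le_sum fun i _ => by
        rw [abs_mul]
        exact mul_le_mul (hc J i) (hV i) (abs_nonneg _) (Nat.cast_nonneg _)
      _ = Fintype.card ι * Fintype.card ι * B := by
        rw [Finset.sum_const, card_univ, nsmul_eq_mul, mul_assoc]

end Payoffs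

/-! ### Weighted means of equilibrium payoffs -/

/-- A weighted mean of static equilibrium payoffs is a uniform equilibrium payoff: the equilibria
are played in turn, in long phases with frequencies `α`. -/
theorem sum_smul_staticPayoff_mem_uniformEquilibriumPayoffs {Ω M A ι : Type*} [Fintype Ω]
    [DecidableEq Ω] [Fintype M] [Fintype A] [Fintype ι] {Q : Matrix Ω Ω ℝ} {μ : stdSimplex ℝ Ω}
    {b : ℝ} (hQ : Q ∈ Matrix.rowStochastic ℝ Ω) (hμ : IsInvariantDist Q μ)
    (hren : IsRenewal Q μ b) (hb0 : 0 < b) (hb1 : b ≤ 1) {uS uR : Ω → A → ℝ}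
    {l : ι → stdSimplex ℝ M} {p : ι → M → stdSimplex ℝ Ω} {κ : ι → M → stdSimplex ℝ A}
    (heq : ∀ k, IsStaticEquilibrium uS uR μ (l k) (p k) (κ k))
    {α : ι → ℝ} (hα : ∀ k, 0 ≤ α k) (hα1 : ∑ k, α k = 1) :
    (∑ k, α k * staticPayoff uS (l k) (p k) (κ k), ∑ k, α k * staticPayoff uR (l k) (p k) (κ k))
      ∈ uniformEquilibriumPayoffs M Q μ uS uR := by
  classical
  obtain ⟨BS, hBS⟩ := exists_abs_le uS
  obtain ⟨BR, hBR⟩ := exists_abs_le uR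
  obtain ⟨B, hB0, hS, hR⟩ : ∃ B : ℝ, 0 < B ∧ (∀ ω a, |uS ω a| ≤ B) ∧ ∀ ω a, |uR ω a| ≤ B :=
    ⟨max 1 (max BS BR), lt_max_of_lt_left one_pos,
      fun ω a => (hBS ω a).trans ((le_max_left _ _).trans (le_max_right _ _)),
      fun ω a => (hBR ω a).trans ((le_max_right _ _).trans (le_max_right _ _))⟩
  obtain ⟨c, hc⟩ := exists_balanced_sequence hα hα1
  have hp : ∀ k, p k ∈ bayesPlausible μ (l k) := fun k => (heq k).plausible
  refine mem_uniformEquilibriumPayoffs_of_sums hQ fun ε hε => ?_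
  set I := (Fintype.card ι : ℝ) with hI
  set m := (Fintype.card M : ℝ) with hm
  have hIm : 0 ≤ I * m := by positivity
  -- each of the three sources of error costs only a fraction of `ε` per period: the test,
  -- the resets at the beginnings of the phases, and false alarms
  obtain ⟨η, hη, hηε⟩ : ∃ η : ℝ, 0 < η ∧ I * (2 * B * m * (2 * η)) ≤ ε / 2 := by
    refine ⟨ε / (8 * B * (I * m + 1)), by positivity, ?_⟩
    have h1 : I * (2 * B * m * (2 * (ε / (8 * B * (I * m + 1)))))
        = ε / 2 * (I * m / (I * m + 1)) := by field_simp; ring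
    have h2 : I * m / (I * m + 1) ≤ 1 := div_le_one_of_le₀ (by linarith) (by positivity)
    rw [h1]
    exact mul_le_of_le_one_right (by linarith) h2
  obtain ⟨L, hL, hLε⟩ : ∃ L : ℕ, 0 < L ∧ 2 * B / b / L ≤ ε / 4 := by
    obtain ⟨L, hL⟩ := exists_nat_gt (2 * B / b / (ε / 4))
    have hL0 : (0 : ℝ) < L := lt_of_le_of_lt (by positivity) hL
    exact ⟨L, by exact_mod_cast hL0, (div_le_comm₀ hL0 (by linarith)).2 hL.le⟩
  set P : ℕ → ℝ := fun K => I * m * (1 + 2 * b⁻¹) / η ^ 2 * (2 / K) with hP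
  obtain ⟨K, hK, hKε⟩ : ∃ K : ℕ, 0 < K ∧ 2 * B * P K ≤ ε / 4 := by
    set D : ℝ := 2 * B * (I * m * (1 + 2 * b⁻¹) / η ^ 2 * 2) with hD
    have hD0 : 0 ≤ D := by positivity
    obtain ⟨K, hK⟩ := exists_nat_gt (D / (ε / 4))
    have hK0 : (0 : ℝ) < K := lt_of_le_of_lt (by positivity) hK
    refine ⟨K, by exact_mod_cast hK0, ?_⟩
    have h1 : 2 * B * P K = D / K := by simp only [hP, hD]; ring
    rw [h1]
    exact (div_le_comm₀ hK0 (by linarith)).2 hK.le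
  set i : ℕ → ι := fun n => c (n / L) with hi
  have hRi : ∀ n, ¬L ∣ n + 1 → i (n + 1) = i n := fun n hn => by
    simp only [hi, Nat.succ_div_of_not_dvd hn]
  have hsched : ∀ {u : Ω → A → ℝ}, (∀ ω a, |u ω a| ≤ B) → ∀ N : ℕ,
      |∑ n ∈ range N, staticPayoff u (l (i n)) (p (i n)) (κ (i n))
        - N * ∑ k, α k * staticPayoff u (l k) (p k) (κ k)| ≤ L * (I * I * B + 2 * B) :=
    fun hu N => abs_sum_schedule_sub_le hα hα1 hc hL (fun k => abs_staticPayoff_le hu _ _ _) N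
  have hbelief : ∀ N : ℕ, ∑ n ∈ range N, B * beliefError b (fun n => L ∣ n) n
      ≤ ε / 4 * N + 2 * B / b := fun N => by
    rw [← Finset.mul_sum]
    have h1 := mul_sum_beliefError_le hb0.le hb1 L N
    have h2 := mul_le_mul_of_nonneg_left h1 (by positivity : 0 ≤ B / b)
    have h3 := mul_le_mul_of_nonneg_right hLε (Nat.cast_nonneg (α := ℝ) N)
    have h4 : B / b * (b * ∑ n ∈ range N, beliefError b (fun n => L ∣ n) n)
        = B * ∑ n ∈ range N, beliefError b (fun n => L ∣ n) n := by field_simp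
    have h5 : B / b * (2 + 2 * (N / L)) = 2 * B / b / L * N + 2 * B / b := by ring
    linarith
  have hpath : ∀ u : Ω → A → ℝ, (∀ ω a, |u ω a| ≤ B) → ∀ N : ℕ,
      ∑ n ∈ range N, staticPayoff u (l (i n)) (p (i n)) (κ (i n)) - (ε / 2 * N + 2 * B / b)
      ≤ ∑ n ∈ range N, expectedStagePayoff Q μ u (renewalSender b l p i fun n => L ∣ n)
          (testReceiver l κ i η K) n := fun u hu N => by
    have h1 : ∑ n ∈ range N, (staticPayoff u (l (i n)) (p (i n)) (κ (i n))
        - expectedStagePayoff Q μ u (renewalSender b l p i fun n => L ∣ n)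
          (testReceiver l κ i η K) n)
        ≤ ∑ n ∈ range N, (B * beliefError b (fun n => L ∣ n) n + ε / 4) :=
      Finset.sum_le_sum fun n _ => by
        have h2 := (abs_le.1 (abs_expectedStagePayoff_sub_staticPayoff_le (κ := κ) (η := η) (K := K)
          (R := fun n => L ∣ n) hQ hren hb0.le hb1 hp hRi hu n)).1
        have h3 := playExp_triggered_le (τ := testReceiver l κ i η K) (R := fun n => L ∣ n)
          hQ hren hb0 hb1 hp hRi hη hK n
        have h4 := (mul_le_mul_of_nonneg_left h3 (by linarith : 0 ≤ 2 * B)).trans hKε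
        linarith
    rw [Finset.sum_sub_distrib, Finset.sum_add_distrib, Finset.sum_const, card_range,
      nsmul_eq_mul] at h1
    linarith [hbelief N]
  have hcst : 0 ≤ I * (2 * B * m * (η⁻¹ + K ^ 2 + 1)) := by positivity
  have hBb : 0 ≤ 2 * B / b := by positivity
  refine ⟨renewalSender b l p i fun n => L ∣ n, testReceiver l κ i η K,
    L * (I * I * B + 2 * B) + 2 * B / b + I * (2 * B * m * (η⁻¹ + K ^ 2 + 1)),
    fun σ' N => ?_, fun τ' N => ?_, fun N => ?_, fun N => ?_⟩
  · have h1 := sum_expectedStagePayoff_testReceiver_le (K := K) (i := i) hQ hμ heq hS hη σ' N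
    have h2 := (abs_le.1 (hsched hS N)).2
    have h3 := mul_le_mul_of_nonneg_right hηε (Nat.cast_nonneg (α := ℝ) N)
    have h4 : 0 ≤ ε * N := by positivity
    rw [← hI, ← hm] at h1
    linarith
  · have h1 := Finset.sum_le_sum fun n (_ : n ∈ range N) =>
      expectedStagePayoff_renewalSender_le hQ hren hb0.le hb1 heq hRi hR τ' n
    rw [Finset.sum_add_distrib] at h1
    have h2 := (abs_le.1 (hsched hR N)).2
    have h3 : 0 ≤ ε * N := by positivity
    linarith [hbelief N]
  · have h1 := (abs_le.1 (hsched hS N)).1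
    have h2 : 0 ≤ ε * N := by positivity
    linarith [hpath uS hS N]
  · have h1 := (abs_le.1 (hsched hR N)).1
    have h2 : 0 ≤ ε * N := by positivity
    linarith [hpath uR hR N]

end Persuasion

theorem theorem1 {Ω M A : Type*} [Fintype Ω] [DecidableEq Ω] [Fintype M] [Fintype A]
    (Q : Matrix Ω Ω ℝ) (hQ : Q ∈ Matrix.rowStochastic ℝ Ω)
    (hirr : Q.IsIrreducible) (haper : Persuasion.IsAperiodic Q)
    (hpr : Persuasion.IsPseudoRenewal Q)
    (μ : stdSimplex ℝ Ω) (hμ : Persuasion.IsInvariantDist Q μ)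
    (uS uR : Ω → A → ℝ) :
    (∀ l : stdSimplex ℝ M, Persuasion.staticEquilibriumPayoffs uS uR μ l ⊆
      Persuasion.uniformEquilibriumPayoffs M Q μ uS uR) ∧
    convexHull ℝ (⋃ l : stdSimplex ℝ M, Persuasion.staticEquilibriumPayoffs uS uR μ l) ⊆
      Persuasion.uniformEquilibriumPayoffs M Q μ uS uR := by
  have hconv : convexHull ℝ (⋃ l : stdSimplex ℝ M, Persuasion.staticEquilibriumPayoffs uS uR μ l) ⊆
      Persuasion.uniformEquilibriumPayoffs M Q μ uS uR := by
    obtain ⟨b, hb0, hb1, hren⟩ := Persuasion.exists_isRenewal hQ hirr hpr hμ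
    intro γ hγ
    obtain ⟨ι, _, α, z, hα, hα1, hz, rfl⟩ := mem_convexHull_iff_exists_fintype.1 hγ
    choose l hl using fun k => Set.mem_iUnion.1 (hz k)
    choose p κ heq hzk using hl
    have := Persuasion.sum_smul_staticPayoff_mem_uniformEquilibriumPayoffs hQ hμ hren hb0 hb1 heq
      hα hα1
    convert this using 1
    ext
    · simp [Prod.fst_sum, hzk]
    · simp [Prod.snd_sum, hzk]
  exact ⟨fun l => ((Set.subset_iUnion _ l).trans (subset_convexHull ℝ _)).trans hconv, hconv⟩
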